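/- Let $f\not\equiv 0$ be a weakly holomorphic modular function for $\mathrm{SL}(2,\mathbb{Z})$ (i.e. $f$ is holomorphic on the upper half plane $\mathbb{H}$, invariant under $\mathrm{SL}(2,\mathbb{Z})$, and meromorphic at the cusp $\infty$) that is real and non-negative on the arc $\{e^{it}:\pi/3\le t\le 2\pi/3\}$. For a hyperbolic matrix $A\in\mathrm{SL}(2,\mathbb{Z})$ with repelling fixed point $w$ and attracting fixed point $\tilde w$, let $Q(x,y)=ax^2+bxy+cy^2$ be the primitive integral binary quadratic form with $Q(w,1)=Q(\tilde w,1)=0$ and $\mathrm{sgn}(a)=\mathrm{sgn}(w-\tilde w)$, let $D=b^2-4ac$, and put $$I_f(A)=\int_{\tau_0}^{A\tau_0}\frac{f(\tau)\sqrt D}{Q(\tau,1)}\,d\tau$$ (for any $\tau_0\in\mathbb{H}$); put $I_f(A)=0$ if $A$ is not hyperbolic. Let $T=\begin{pmatrix}1&1\\0&1\end{pmatrix}$ and $V=\begin{pmatrix}1&0\\1&1\end{pmatrix}$. For real $x>0$ let $(A_n)_{n\ge 0}$ be the sequence of matrices along the path in the Farey tree from $\frac11$ to $x$: $A_0=I$,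 each $A_{n+1}$ is $A_nT$ or $A_nV$, and $A_n(1)\to x$ (where $\begin{pmatrix}\alpha&\beta\\\gamma&\delta\end{pmatrix}(1)=\frac{\alpha+\beta}{\gamma+\delta}$), where for rational $x$ one takes the path with $A_{n+1}=A_nV$ for all large $n$. Define $$\Lambda_f(x)=\limsup_{n\to\infty}\frac{\mathrm{Re}(I_f(A_n))}{n}\quad(x>0),$$ and extend $\Lambda_f$ to $\mathbb{P}^1(\mathbb{R})=\mathbb{R}\cup\{\infty\}$ by $\Lambda_f(x)=\Lambda_f(-x)$ for $x<0$ and $\Lambda_f(0)=\Lambda_f(\infty)=0$. Then this limit superior is finite for every $x>0$, and, with $\phi=\frac{1+\sqrt5}{2}$ the golden ratio, $$0\le\Lambda_f(x)\le\Lambda_f(\phi)\qquad\text{for every }x\in\mathbb{P}^1(\mathbb{R}).$$ Moreover, every value in $[0,\Lambda_f(\phi)]$ is attained by $\Lambda_f$; equivalently, $\Lambda_f(\mathbb{P}^1(\mathbb{R}))=[0,\Lambda_f(\phi)]$. -/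

import Mathlib

open UpperHalfPlane Filter Topology Set
open scoped Real MatrixGroups Manifold

noncomputable section

namespace ModularLyapunov

/-! ### Modular functions -/

/-- Weakly holomorphic modular functions for `SL(2, ℤ)`: holomorphic on the upper half plane,
invariant under `SL(2, ℤ)`, and meromorphic at the cusp `∞`. The function `cuspFunction 1 f` is `f`
written in the variable `q = exp (2 π i τ)`. -/
structure IsWeaklyHolomorphicModularFunction (f : ℍ → ℂ) : Prop where
  holo : MDifferentiable 𝓘(ℂ) 𝓘(ℂ) f
  invariant : ∀ (γ : SL(2, ℤ)) (τ : ℍ), f (γ • τ) = f τ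
  meromorphic_infty : MeromorphicAt (UpperHalfPlane.cuspFunction 1 f) 0

/-- `f` is real and non-negative on the arc `{exp (i t) : π / 3 ≤ t ≤ 2 π / 3}`. -/
def NonnegOnArc (f : ℍ → ℂ) : Prop :=
  ∀ t ∈ Icc (π / 3) (2 * π / 3), ∀ τ : ℍ, (τ : ℂ) = Complex.exp (t * Complex.I) →
    (f τ).im = 0 ∧ 0 ≤ (f τ).re

/-! ### Cycle integrals -/

/-- An integral binary quadratic form `Q(x, y) = a x² + b x y + c y²`. -/
structure BinForm where
  a : ℤ
  b : ℤ
  c : ℤ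

namespace BinForm

/-- The discriminant `D = b² - 4 a c`. -/
def disc (Q : BinForm) : ℤ := Q.b ^ 2 - 4 * Q.a * Q.c

/-- The value `Q(z, 1)`. -/
def evalOne (Q : BinForm) (z : ℂ) : ℂ := Q.a * z ^ 2 + Q.b * z + Q.c

/-- The root `(-b + √D) / (2 a)` of `Q(x, 1)`. -/
def root (Q : BinForm) : ℝ := (-(Q.b : ℝ) + √(Q.disc : ℝ)) / (2 * Q.a)

/-- The root `(-b - √D) / (2 a)` of `Q(x, 1)`. -/
def root' (Q : BinForm) : ℝ := (-(Q.b : ℝ) - √(Q.disc : ℝ)) / (2 * Q.a)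

end BinForm

/-- A matrix in `SL(2, ℤ)` is hyperbolic if its trace has absolute value greater than `2`. -/
def IsHyperbolic (A : SL(2, ℤ)) : Prop := 2 < |A.1.trace|

/-- The greatest common divisor of the coefficients of the form
`A₁₀ x² + (A₁₁ - A₀₀) x y - A₀₁ y²`, which vanishes at the fixed points of `A`. -/
def fixGcd (A : SL(2, ℤ)) : ℕ := Int.gcd (Int.gcd (A 1 0) (A 1 1 - A 0 0)) (A 0 1)

/-- For hyperbolic `A`, the primitive integral form `Q` that vanishes at the fixed points of `A`,
with the sign such that `Q.root = (-b + √D) / (2 a)` is the repelling fixed point and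
`Q.root' = (-b - √D) / (2 a)` is the attracting one; see `cycleForm_spec`. -/
def cycleForm (A : SL(2, ℤ)) : BinForm where
  a := -A.1.trace.sign * (A 1 0 / fixGcd A)
  b := -A.1.trace.sign * ((A 1 1 - A 0 0) / fixGcd A)
  c := A.1.trace.sign * (A 0 1 / fixGcd A)

/-- The defining properties of `cycleForm A` for hyperbolic `A = (α β; γ δ)`: it is primitive and
indefinite, its roots are the fixed points of `A`, the root `w = (-b + √D) / (2 a)` is repelling
(the derivative `(γ w + δ)⁻²` of the action at `w` exceeds `1`), the root `w' = (-b - √D) / (2 a)`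
is attracting, and `sgn a = sgn (w - w')`. -/
theorem cycleForm_spec (A : SL(2, ℤ)) (hA : IsHyperbolic A) :
    Int.gcd (Int.gcd (cycleForm A).a (cycleForm A).b) (cycleForm A).c = 1 ∧
    0 < (cycleForm A).disc ∧
    (∀ w : ℝ, (w = (cycleForm A).root ∨ w = (cycleForm A).root') →
      (A 1 0 : ℝ) * w + A 1 1 ≠ 0 ∧
      ((A 0 0 : ℝ) * w + A 0 1) / ((A 1 0 : ℝ) * w + A 1 1) = w) ∧
    |(A 1 0 : ℝ) * (cycleForm A).root + A 1 1| < 1 ∧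
    1 < |(A 1 0 : ℝ) * (cycleForm A).root' + A 1 1| ∧
    SignType.sign ((cycleForm A).a : ℝ) =
      SignType.sign ((cycleForm A).root - (cycleForm A).root') := by
  have hdet : A 0 0 * A 1 1 - A 0 1 * A 1 0 = 1 := by
    have := A.2
    rwa [Matrix.det_fin_two] at this
  have htr : A.1.trace = A 0 0 + A 1 1 := Matrix.trace_fin_two _
  set α : ℤ := A 0 0 with hα
  set β : ℤ := A 0 1 with hβ
  set γ : ℤ := A 1 0 with hγ
  set δ : ℤ := A 1 1 with hδ
  set t : ℤ := A.1.trace with ht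
  have ht2 : 2 < |t| := hA
  have hγ0 : γ ≠ 0 := by
    intro h
    rw [h] at hdet
    have h1 : α * δ = 1 := by linarith
    rcases Int.mul_eq_one_iff_eq_one_or_neg_one.mp h1 with ⟨h2, h3⟩ | ⟨h2, h3⟩
    · rw [htr, h2, h3] at ht2; norm_num at ht2
    · rw [htr, h2, h3] at ht2; norm_num at ht2
  set g : ℕ := fixGcd A with hg
  have hgdef : g = Int.gcd (Int.gcd γ (δ - α)) β := rfl
  have hgpos : 0 < g := by
    rw [hgdef]
    apply Int.gcd_pos_of_ne_zero_left
    have := Int.gcd_pos_of_ne_zero_left (δ - α) hγ0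
    omega
  have hga : (g : ℤ) ∣ γ :=
    (Int.gcd_dvd_left (Int.gcd γ (δ - α) : ℤ) β).trans (Int.gcd_dvd_left _ _)
  have hgb : (g : ℤ) ∣ δ - α :=
    (Int.gcd_dvd_left (Int.gcd γ (δ - α) : ℤ) β).trans (Int.gcd_dvd_right _ _)
  have hgc : (g : ℤ) ∣ β := Int.gcd_dvd_right _ _
  obtain ⟨p, hp⟩ := hga
  obtain ⟨q, hq⟩ := hgb
  obtain ⟨r, hr⟩ := hgc
  have hgz : (g : ℤ) ≠ 0 := by omega
  have hprim : Int.gcd (Int.gcd p q) r = 1 := by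
    have h1 : Int.gcd γ (δ - α) = g * Int.gcd p q := by
      rw [hp, hq, Int.gcd_mul_left]; simp
    have h2 : g = g * Int.gcd (Int.gcd p q) r := by
      conv_lhs => rw [hgdef, h1, hr]
      rw [Nat.cast_mul, Int.gcd_mul_left]; simp
    exact Nat.eq_of_mul_eq_mul_left hgpos (by omega)
  have hσ : t.sign = 1 ∨ t.sign = -1 := by
    rcases lt_trichotomy t 0 with h | h | h
    · right; exact Int.sign_eq_neg_one_of_neg h
    · rw [h] at ht2; norm_num at ht2
    · left; exact Int.sign_eq_one_of_pos h
  have hσt : (t.sign : ℤ) * t = |t| := by rw [mul_comm]; exact Int.mul_sign_self t |>.trans (Int.abs_eq_natAbs t).symm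
  set σ : ℤ := t.sign with hσd
  have hσ2 : σ * σ = 1 := by rcases hσ with h | h <;> rw [h] <;> norm_num
  have ha : (cycleForm A).a = -σ * p := by
    show -σ * (γ / g) = _
    rw [hp, Int.mul_ediv_cancel_left _ hgz]
  have hb : (cycleForm A).b = -σ * q := by
    show -σ * ((δ - α) / g) = _
    rw [hq, Int.mul_ediv_cancel_left _ hgz]
  have hc : (cycleForm A).c = σ * r := by
    show σ * (β / g) = _
    rw [hr, Int.mul_ediv_cancel_left _ hgz]
  have hD : (cycleForm A).disc = q ^ 2 + 4 * p * r := by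
    unfold BinForm.disc
    rw [ha, hb, hc]
    linear_combination (q ^ 2 + 4 * p * r) * hσ2
  have hDg : (g : ℤ) ^ 2 * (cycleForm A).disc = t ^ 2 - 4 := by
    rw [hD, htr]
    have : (g : ℤ) ^ 2 * (q ^ 2 + 4 * p * r) = (δ - α) ^ 2 + 4 * γ * β := by
      rw [hp, hq, hr]; ring
    rw [this]
    linear_combination (-4) * hdet
  have ht4 : 0 < t ^ 2 - 4 := by
    have : t ^ 2 = |t| ^ 2 := (sq_abs t).symm
    nlinarith
  have hDpos : 0 < (cycleForm A).disc := by
    have : 0 < (g : ℤ) ^ 2 * (cycleForm A).disc := by rw [hDg]; exact ht4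
    exact pos_of_mul_pos_right this (sq_nonneg _)
  have hp0 : p ≠ 0 := by rintro rfl; simp at hp; exact hγ0 hp
  -- pass to the reals
  set s : ℝ := √((cycleForm A).disc : ℝ) with hs
  have hspos : 0 < s := Real.sqrt_pos.mpr (by exact_mod_cast hDpos)
  have hs2 : s ^ 2 = ((cycleForm A).disc : ℝ) := Real.sq_sqrt (by exact_mod_cast hDpos.le)
  have hpR : (p : ℝ) ≠ 0 := by exact_mod_cast hp0
  have hgR : (0 : ℝ) < g := by exact_mod_cast hgpos
  have hσR : (σ : ℝ) * σ = 1 := by exact_mod_cast hσ2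
  have hσR0 : (σ : ℝ) ≠ 0 := by intro h; rw [h] at hσR; norm_num at hσR
  have hγR : (γ : ℝ) = g * p := by exact_mod_cast hp
  have hqR : (δ : ℝ) - α = g * q := by exact_mod_cast hq
  have hrR : (β : ℝ) = g * r := by exact_mod_cast hr
  have htR : (t : ℝ) = α + δ := by exact_mod_cast htr
  have hdetR : (α : ℝ) * δ - β * γ = 1 := by exact_mod_cast hdet
  have hgs : (g * s) ^ 2 = (t : ℝ) ^ 2 - 4 := by
    rw [mul_pow, hs2]; exact_mod_cast hDg
  have htabs : (σ : ℝ) * t = |(t : ℝ)| := by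
    have : ((σ * t : ℤ) : ℝ) = ((|t| : ℤ) : ℝ) := by rw [hσt]
    push_cast at this; exact this
  have htgt : (2 : ℝ) < |(t : ℝ)| := by exact_mod_cast ht2
  have hroot : (cycleForm A).root = (σ * q + s) / (-(2 * σ * p)) := by
    unfold BinForm.root
    rw [ha, hb, ← hs]; push_cast; congr 1 <;> ring
  have hroot' : (cycleForm A).root' = (σ * q - s) / (-(2 * σ * p)) := by
    unfold BinForm.root'
    rw [ha, hb, ← hs]; push_cast; congr 1 <;> ring
  have e1 : (γ : ℝ) * (cycleForm A).root + δ = σ * (|(t : ℝ)| - g * s) / 2 := by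
    rw [hroot, hγR, ← htabs, htR]
    field_simp
    linear_combination (σ : ℝ) * hqR + (α + δ : ℝ) * (-σ : ℝ) * hσR + (g * s : ℝ) * (hσR)
  have e2 : (γ : ℝ) * (cycleForm A).root' + δ = σ * (|(t : ℝ)| + g * s) / 2 := by
    rw [hroot', hγR, ← htabs, htR]
    field_simp
    linear_combination (σ : ℝ) * hqR + (α + δ : ℝ) * (-σ : ℝ) * hσR - (g * s : ℝ) * (hσR)
  have hgs0 : 0 < g * s := mul_pos hgR hspos
  have hprod : (|(t : ℝ)| - g * s) * (|(t : ℝ)| + g * s) = 4 := by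
    have := sq_abs (t : ℝ)
    linear_combination this - hgs
  have hlow : 0 < |(t : ℝ)| - g * s := by
    by_contra! h
    nlinarith
  have habsσ : |(σ : ℝ)| = 1 := by
    rcases hσ with h | h <;> rw [h] <;> norm_num
  have hs2' : s ^ 2 = (q : ℝ) ^ 2 + 4 * p * r := by rw [hs2]; exact_mod_cast hD
  refine ⟨?_, hDpos, ?_, ?_, ?_, ?_⟩
  · rw [ha, hb, hc]
    rcases hσ with h | h <;> rw [h] <;> simpa using hprim
  · have key : ∀ w : ℝ, (p : ℝ) * w ^ 2 + q * w - r = 0 → (γ : ℝ) * w + δ ≠ 0 →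
        ((α : ℝ) * w + β) / ((γ : ℝ) * w + δ) = w := by
      intro w hw h0
      rw [div_eq_iff h0, hrR, hγR]
      linear_combination (-(g : ℝ)) * hw - w * hqR
    rintro w (rfl | rfl)
    · have h0 : (γ : ℝ) * (cycleForm A).root + δ ≠ 0 := by
        rw [e1]
        exact div_ne_zero (mul_ne_zero hσR0 hlow.ne') two_ne_zero
      refine ⟨h0, key _ ?_ h0⟩
      rw [hroot]
      field_simp
      linear_combination hs2' + (q ^ 2 - 2 * q ^ 2 - 4 * p * r : ℝ) * hσR
    · have h0 : (γ : ℝ) * (cycleForm A).root' + δ ≠ 0 := by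
        rw [e2]
        exact div_ne_zero (mul_ne_zero hσR0 (by linarith)) two_ne_zero
      refine ⟨h0, key _ ?_ h0⟩
      rw [hroot']
      field_simp
      linear_combination hs2' + (q ^ 2 - 2 * q ^ 2 - 4 * p * r : ℝ) * hσR
  · rw [e1, abs_div, abs_mul, habsσ, one_mul, abs_of_pos hlow, abs_two,
      div_lt_one two_pos]
    nlinarith
  · rw [e2, abs_div, abs_mul, habsσ, one_mul, abs_two, one_lt_div two_pos]
    rw [abs_of_pos (by linarith)]
    linarith
  · have : (cycleForm A).root - (cycleForm A).root' = s / (cycleForm A).a := by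
      unfold BinForm.root BinForm.root'
      rw [← hs]; ring
    rw [this, div_eq_mul_inv, sign_mul, sign_pos hspos, one_mul]
    rcases lt_trichotomy ((cycleForm A).a : ℝ) 0 with h | h | h
    · rw [sign_neg h, sign_neg (inv_lt_zero.mpr h)]
    · rw [h]; simp
    · rw [sign_pos h, sign_pos (inv_pos.mpr h)]

/-- The integrand `f(z) √D / Q(z, 1)`, as a function of `z` in the upper half plane. -/
def cycleIntegrand (f : ℍ → ℂ) (Q : BinForm) (z : ℂ) : ℂ :=
  f (ofComplex z) * (√(Q.disc : ℝ) : ℝ) / Q.evalOne z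

open Classical in
/-- The cycle integral `I_f(A) = ∫ f(τ) √D / Q(τ, 1) dτ` from `τ₀` to `A τ₀`, with `τ₀ = i`, along
the straight segment (which lies in the upper half plane); the integral does not depend on the path,
nor on `τ₀`, when `f` is holomorphic and invariant. By convention it is `0` if `A` is not
hyperbolic. -/
def cycleIntegral (f : ℍ → ℂ) (A : SL(2, ℤ)) : ℂ :=
  if IsHyperbolic A then
    ∫ s in (0 : ℝ)..1,
      cycleIntegrand f (cycleForm A)
          (AffineMap.lineMap (Complex.I : ℂ) ((A • UpperHalfPlane.I : ℍ) : ℂ) s) *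
        (((A • UpperHalfPlane.I : ℍ) : ℂ) - Complex.I)
  else 0

/-! ### Farey paths -/

/-- `T = (1 1; 0 1)`. -/
def T : SL(2, ℤ) := ⟨!![1, 1; 0, 1], by simp [Matrix.det_fin_two]⟩

/-- `V = (1 0; 1 1)`. -/
def V : SL(2, ℤ) := ⟨!![1, 0; 1, 1], by simp [Matrix.det_fin_two]⟩

/-- The Farey fraction `A(1) = (a + c) / (b + d)` to which `A = (c a; d b)` is associated. -/
def fareyFraction (A : SL(2, ℤ)) : ℝ :=
  ((A 0 0 : ℝ) + (A 0 1 : ℝ)) / ((A 1 0 : ℝ) + (A 1 1 : ℝ))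

open Classical in
/-- The matrices `Aₙ` along the path in the Farey tree (started at `1/1`) that converges to `x > 0`:
`Aₙ` is multiplied on the right by `V` when the path turns to the smaller direct descendant of
`xₙ = Aₙ(1)`, and by `T` when it turns to the larger one. At `xₙ = x` the path turns to the larger
descendant, and hence to the smaller one ever after: of the two paths to a positive rational number,
this is the one that ends in `V, V, V, …`. See `fareyMatrix_spec`. -/
def fareyMatrix (x : ℝ) : ℕ → SL(2, ℤ)
  | 0 => 1
  | n + 1 => if x < fareyFraction (fareyMatrix x n) then fareyMatrix x n * V
      else fareyMatrix x n * T

/-- One step of the path. -/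
theorem fareyMatrix_step (x : ℝ) (n : ℕ) :
    (x < fareyFraction (fareyMatrix x n) ∧ fareyMatrix x (n + 1) = fareyMatrix x n * V) ∨
    (fareyFraction (fareyMatrix x n) ≤ x ∧ fareyMatrix x (n + 1) = fareyMatrix x n * T) := by
  by_cases h : x < fareyFraction (fareyMatrix x n)
  · exact Or.inl ⟨h, by simp [fareyMatrix, h]⟩
  · exact Or.inr ⟨not_lt.mp h, by simp [fareyMatrix, h]⟩

theorem mul_V_apply (A : SL(2, ℤ)) : (A * V) 0 0 = A 0 0 + A 0 1 ∧ (A * V) 0 1 = A 0 1 ∧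
    (A * V) 1 0 = A 1 0 + A 1 1 ∧ (A * V) 1 1 = A 1 1 := by
  have h : V.1 = !![1, 0; 1, 1] := rfl
  simp only [Matrix.SpecialLinearGroup.coe_mul, h, Matrix.mul_apply, Fin.sum_univ_two]
  simp

theorem mul_T_apply (A : SL(2, ℤ)) : (A * T) 0 0 = A 0 0 ∧ (A * T) 0 1 = A 0 0 + A 0 1 ∧
    (A * T) 1 0 = A 1 0 ∧ (A * T) 1 1 = A 1 0 + A 1 1 := by
  have h : T.1 = !![1, 1; 0, 1] := rfl
  simp only [Matrix.SpecialLinearGroup.coe_mul, h, Matrix.mul_apply, Fin.sum_univ_two]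
  simp

/-- The interval `[a / b, c / d)` cut out by `Aₙ = (c a; d b)` contains `x`. -/
theorem fareyMatrix_bounds (x : ℝ) (hx : 0 < x) (n : ℕ) :
    0 ≤ fareyMatrix x n 0 1 ∧ 1 ≤ fareyMatrix x n 1 1 ∧ 1 ≤ fareyMatrix x n 0 0 ∧
    0 ≤ fareyMatrix x n 1 0 ∧
    (fareyMatrix x n 0 1 : ℝ) ≤ x * fareyMatrix x n 1 1 ∧
    x * fareyMatrix x n 1 0 < fareyMatrix x n 0 0 := by
  induction n with
  | zero => simp [fareyMatrix, hx.le]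
  | succ n ih =>
    obtain ⟨h1, h2, h3, h4, h5, h6⟩ := ih
    have hbd : (0 : ℝ) < (fareyMatrix x n 1 0 : ℝ) + fareyMatrix x n 1 1 := by
      have : (0 : ℤ) < fareyMatrix x n 1 0 + fareyMatrix x n 1 1 := by omega
      exact_mod_cast this
    rcases fareyMatrix_step x n with ⟨h, e⟩ | ⟨h, e⟩
    · obtain ⟨m1, m2, m3, m4⟩ := mul_V_apply (fareyMatrix x n)
      rw [e, m1, m2, m3, m4]
      rw [fareyFraction, lt_div_iff₀ hbd] at h
      refine ⟨h1, h2, by omega, by omega, h5, ?_⟩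
      push_cast; exact h
    · obtain ⟨m1, m2, m3, m4⟩ := mul_T_apply (fareyMatrix x n)
      rw [e, m1, m2, m3, m4]
      rw [fareyFraction, div_le_iff₀ hbd] at h
      refine ⟨by omega, by omega, h3, h4, ?_, h6⟩
      push_cast; exact h

/-- The path of `x > 0` starts at `1/1` and moves to a direct descendant in each step, it converges
to `x`, and it ends in turns to the smaller descendant if `x` is rational. -/
theorem fareyMatrix_spec (x : ℝ) (hx : 0 < x) :
    fareyMatrix x 0 = 1 ∧
    (∀ n, (fareyFraction (fareyMatrix x (n + 1)) < fareyFraction (fareyMatrix x n) ∧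
        fareyMatrix x (n + 1) = fareyMatrix x n * V) ∨
      (fareyFraction (fareyMatrix x n) < fareyFraction (fareyMatrix x (n + 1)) ∧
        fareyMatrix x (n + 1) = fareyMatrix x n * T)) ∧
    Tendsto (fun n => fareyFraction (fareyMatrix x n)) atTop (𝓝 x) ∧
    ((∃ r : ℚ, x = r) → ∃ N, ∀ n ≥ N, fareyMatrix x (n + 1) = fareyMatrix x n * V) := by
  have hdet : ∀ A : SL(2, ℤ), (A 0 0 : ℝ) * A 1 1 - A 0 1 * A 1 0 = 1 := by
    intro A
    have := A.2
    rw [Matrix.det_fin_two] at this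
    exact_mod_cast this
  have hR : ∀ n, (0 : ℝ) ≤ fareyMatrix x n 0 1 ∧ (1 : ℝ) ≤ fareyMatrix x n 1 1 ∧
      (1 : ℝ) ≤ fareyMatrix x n 0 0 ∧ (0 : ℝ) ≤ fareyMatrix x n 1 0 := by
    intro n
    obtain ⟨h1, h2, h3, h4, -, -⟩ := fareyMatrix_bounds x hx n
    exact ⟨by exact_mod_cast h1, by exact_mod_cast h2, by exact_mod_cast h3, by exact_mod_cast h4⟩
  refine ⟨rfl, ?_, ?_, ?_⟩
  · intro n
    obtain ⟨h1, h2, h3, h4⟩ := hR n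
    have hd := hdet (fareyMatrix x n)
    rcases fareyMatrix_step x n with ⟨-, e⟩ | ⟨-, e⟩
    · left
      refine ⟨?_, e⟩
      obtain ⟨m1, m2, m3, m4⟩ := mul_V_apply (fareyMatrix x n)
      rw [e, fareyFraction, fareyFraction, m1, m2, m3, m4]
      push_cast
      rw [div_lt_div_iff₀ (by linarith) (by linarith)]
      nlinarith
    · right
      refine ⟨?_, e⟩
      obtain ⟨m1, m2, m3, m4⟩ := mul_T_apply (fareyMatrix x n)
      rw [e, fareyFraction, fareyFraction, m1, m2, m3, m4]
      push_cast
      rw [div_lt_div_iff₀ (by linarith) (by linarith)]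
      nlinarith
  · -- the denominator grows at least by one per step once the path has turned to `V`
    have hV : ∃ N, 1 ≤ fareyMatrix x N 1 0 := by
      by_contra! hcon
      have h0 : ∀ n, fareyMatrix x n 1 0 = 0 := fun n => by
        have := (fareyMatrix_bounds x hx n).2.2.2.1
        have := hcon n
        omega
      have h1 : ∀ n, fareyMatrix x n 0 0 = 1 ∧ fareyMatrix x n 0 1 = n ∧
          fareyMatrix x n 1 1 = 1 := by
        intro n
        induction n with
        | zero => simp [fareyMatrix]
        | succ n ih =>
          obtain ⟨i1, i2, i3⟩ := ih
          rcases fareyMatrix_step x n with ⟨-, e⟩ | ⟨-, e⟩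
          · exfalso
            have := h0 (n + 1)
            rw [e, (mul_V_apply _).2.2.1, h0 n, i3] at this
            norm_num at this
          · obtain ⟨m1, m2, m3, m4⟩ := mul_T_apply (fareyMatrix x n)
            rw [e, m1, m2, m4, i1, i2, i3, h0 n]
            refine ⟨rfl, by push_cast; ring, by norm_num⟩
      obtain ⟨n, hn⟩ := exists_nat_gt x
      have := (fareyMatrix_bounds x hx n).2.2.2.2.1
      rw [(h1 n).2.1, (h1 n).2.2] at this
      push_cast at this
      linarith
    obtain ⟨N, hN⟩ := hV
    have hgrow : ∀ k : ℕ, 1 ≤ fareyMatrix x (N + k) 1 0 ∧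
        (k : ℤ) + 1 ≤ fareyMatrix x (N + k) 1 0 + fareyMatrix x (N + k) 1 1 := by
      intro k
      induction k with
      | zero =>
        have := (fareyMatrix_bounds x hx N).2.1
        refine ⟨hN, ?_⟩
        simp only [Nat.add_zero]; push_cast; omega
      | succ k ih =>
        have h2 := (fareyMatrix_bounds x hx (N + k)).2.1
        rw [← add_assoc]
        rcases fareyMatrix_step x (N + k) with ⟨-, e⟩ | ⟨-, e⟩
        · obtain ⟨m1, m2, m3, m4⟩ := mul_V_apply (fareyMatrix x (N + k))
          rw [e, m3, m4]; push_cast; omega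
        · obtain ⟨m1, m2, m3, m4⟩ := mul_T_apply (fareyMatrix x (N + k))
          rw [e, m3, m4]; push_cast; omega
    have hbound : ∀ k : ℕ, ‖fareyFraction (fareyMatrix x (k + N)) - x‖ ≤ 1 / ((k : ℝ) + 1) := by
      intro k
      rw [add_comm k N]
      obtain ⟨-, h2, -, h4, h5, h6⟩ := fareyMatrix_bounds x hx (N + k)
      obtain ⟨g1, g2⟩ := hgrow k
      have hd := hdet (fareyMatrix x (N + k))
      have h2' : (1 : ℝ) ≤ fareyMatrix x (N + k) 1 1 := by exact_mod_cast h2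
      have g1' : (1 : ℝ) ≤ fareyMatrix x (N + k) 1 0 := by exact_mod_cast g1
      have g2' : (k : ℝ) + 1 ≤ fareyMatrix x (N + k) 1 0 + fareyMatrix x (N + k) 1 1 := by
        exact_mod_cast g2
      unfold fareyFraction
      generalize (fareyMatrix x (N + k) 0 0 : ℝ) = c at *
      generalize (fareyMatrix x (N + k) 0 1 : ℝ) = a at *
      generalize (fareyMatrix x (N + k) 1 0 : ℝ) = d at *
      generalize (fareyMatrix x (N + k) 1 1 : ℝ) = b at *
      have hk : (0 : ℝ) < (k : ℝ) + 1 := by positivity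
      have hdb : 0 < d + b := by linarith
      have e : (c + a) / (d + b) - x = ((c - x * d) - (x * b - a)) / (d + b) := by
        field_simp; ring
      have i1 : c - x * d ≤ 1 := by nlinarith
      have i2 : x * b - a ≤ 1 := by nlinarith
      rw [e, Real.norm_eq_abs, abs_div, abs_of_pos hdb]
      apply div_le_div₀ zero_le_one _ hk g2'
      rw [abs_le]
      constructor <;> linarith
    rw [← tendsto_add_atTop_iff_nat N]
    rw [tendsto_iff_norm_sub_tendsto_zero]
    exact squeeze_zero (fun _ => norm_nonneg _) hbound tendsto_one_div_add_atTop_nhds_zero_nat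
  · rintro ⟨r, rfl⟩
    -- subtractive Euclidean algorithm
    set u : ℕ → ℤ := fun n => r.num * fareyMatrix r n 1 1 - fareyMatrix r n 0 1 * r.den with hu
    set v : ℕ → ℤ := fun n => fareyMatrix r n 0 0 * r.den - r.num * fareyMatrix r n 1 0 with hv
    have hden : (0 : ℝ) < r.den := by exact_mod_cast r.den_pos
    have hr : (r : ℝ) * r.den = r.num := by exact_mod_cast Rat.mul_den_eq_num r
    have hu0 : ∀ n, 0 ≤ u n := by
      intro n
      have h5 := (fareyMatrix_bounds r hx n).2.2.2.2.1
      have h5' := mul_le_mul_of_nonneg_right h5 hden.le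
      have : (0 : ℝ) ≤ (u n : ℝ) := by
        simp only [hu]; push_cast; rw [← hr]; linarith
      exact_mod_cast this
    have hv0 : ∀ n, 0 < v n := by
      intro n
      have h6 := (fareyMatrix_bounds r hx n).2.2.2.2.2
      have h6' := mul_lt_mul_of_pos_right h6 hden
      have : (0 : ℝ) < (v n : ℝ) := by
        simp only [hv]; push_cast; rw [← hr]; linarith
      exact_mod_cast this
    have hstep : ∀ n, (u (n + 1) = u n ∧ v (n + 1) = v n - u n ∧
        fareyMatrix r (n + 1) = fareyMatrix r n * V) ∨
        (u (n + 1) = u n - v n ∧ v (n + 1) = v n) := by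
      intro n
      rcases fareyMatrix_step r n with ⟨-, e⟩ | ⟨-, e⟩
      · obtain ⟨m1, m2, m3, m4⟩ := mul_V_apply (fareyMatrix r n)
        refine Or.inl ⟨?_, ?_, e⟩
        · simp only [hu]; rw [e, m2, m4]
        · simp only [hu, hv]; rw [e, m1, m3]; ring
      · obtain ⟨m1, m2, m3, m4⟩ := mul_T_apply (fareyMatrix r n)
        refine Or.inr ⟨?_, ?_⟩
        · simp only [hu, hv]; rw [e, m2, m4]; ring
        · simp only [hv]; rw [e, m1, m3]
    have hzero : ∃ N, u N = 0 := by
      by_contra! hcon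
      have hdec : ∀ n : ℕ, u n + v n ≤ u 0 + v 0 - n := by
        intro n
        induction n with
        | zero => simp
        | succ n ih =>
          have := hu0 n
          have := hcon n
          have := hv0 n
          rcases hstep n with ⟨h1, h2, -⟩ | ⟨h1, h2⟩ <;> rw [h1, h2] <;> push_cast <;> omega
      have h1 := hdec (u 0 + v 0).toNat
      have := hu0 (u 0 + v 0).toNat
      have := hv0 (u 0 + v 0).toNat
      have := hu0 0
      have := hv0 0
      omega
    obtain ⟨N, hN⟩ := hzero
    have hall : ∀ k, u (N + k) = 0 := by
      intro k
      induction k with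
      | zero => exact hN
      | succ k ih =>
        have := hu0 (N + k + 1)
        have := hv0 (N + k)
        rw [← add_assoc]
        rcases hstep (N + k) with ⟨h1, -, -⟩ | ⟨h1, -⟩ <;> omega
    refine ⟨N, fun n hn => ?_⟩
    obtain ⟨k, rfl⟩ := Nat.exists_eq_add_of_le hn
    have := hall k
    have := hv0 (N + k)
    have := hu0 (N + k + 1)
    rcases hstep (N + k) with ⟨-, -, h⟩ | ⟨h1, -⟩
    · exact h
    · omega

/-! ### The Lyapunov exponent -/

/-- `limsup Re(I_f(Aₙ)) / n` for `x > 0`, as an extended real number. -/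
def lyapunovLimsup (f : ℍ → ℂ) (x : ℝ) : EReal :=
  limsup (fun n : ℕ => (((cycleIntegral f (fareyMatrix x n)).re / n : ℝ) : EReal)) atTop

/-- The `f`-Lyapunov exponent `Λ_f` on `ℙ¹(ℝ) = ℝ ∪ {∞}`: the limit superior above for `x > 0`,
extended by `Λ_f(x) = Λ_f(-x)` for `x < 0` and by `Λ_f(0) = Λ_f(∞) = 0`. -/
def lyapunov (f : ℍ → ℂ) : OnePoint ℝ → ℝ
  | none => 0
  | some x => if x = 0 then 0 else (lyapunovLimsup f |x|).toReal

end ModularLyapunov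

end

namespace ModularLyapunov

/-! ### The kernel -/

/-! Each `Aₙ` is a word in `T` and `V`. If the word is hyperbolic, its attracting fixed point is
some `p > 0`, its repelling one some `-r < 0`, and `√D / Q(z, 1) = 1 / (z + r) - 1 / (z - p)`. Both
letters send `exp (2πi/3)` to `exp (πi/3)`, so with base point `exp (2πi/3)` the path of integration
breaks into translates of the unit arc, one per letter. Pulled back to the arc, the form keeps its
shape while `p` and `r` run through orbits of the word and of its reverse. As `f` is real on the
arc, the real part of the cycle integral becomes a sum of `K(p') + K(r')` over these orbits, where
`K(w) = ∫ f(exp (it)) sin t · w / (w² - 2 w cos t + 1) dt` over `[π/3, 2π/3]`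
(`IsGeodesicPrimitive.re_increment_word`, `exists_re_cycleIntegral_eq`). Since `K ≥ 0`, the lower
bound is immediate.

The upper bound is a coboundary argument. For `x ≥ 1` and `λ = 1 / (2 + φ)` one has `(1 - λ) K(x) +
λ K(x - 1) ≤ K(φ)` (`arcKernel_golden`). With `K(1/w) = K(w)` this says that `K` along an orbit is
at most `K(φ)` plus a telescoping term, which vanishes over a period. So `Re I_f(Aₙ) ≤ 2 n K(φ)`,
and the words `TVTV⋯TV` reach this rate.

For the remaining values the exact fixed points must be forgotten. A word of length `n` contracts
`[0, ∞)` to size `O(1/n)` in the coordinate `p / (1 + p)`, in which `K` is Lipschitz. Hence changing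
the base points changes an orbit sum by a multiple of `1 + 1/2 + ⋯ + 1/n`, which is `o(n)`, and
`twoSidedSum` is additive under concatenation up to such an error. Given `0 ≤ y < 2 K(φ)`, an
infinite word is steered greedily: append `T` if the average is at most `y` and the last letter is
not `T`, and `V` otherwise. Runs of `V` contribute `o(n)`, so the average cannot overshoot; if it
stayed at most `y` forever, the word would end in `TVTV⋯`, whose average tends to `2 K(φ) > y`. So
the limit superior is exactly `y`. -/

/-- The kernel `w / (w² - 2 w cos t + 1)`. -/
noncomputable def arcKernel (t w : ℝ) : ℝ := w / (w ^ 2 - 2 * w * Real.cos t + 1)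

theorem cos_mem_of_mem_arc {t : ℝ} (ht : t ∈ Icc (π / 3) (2 * π / 3)) :
    -(1 / 2) ≤ Real.cos t ∧ Real.cos t ≤ 1 / 2 := by
  have hp := Real.pi_pos
  constructor
  · have h : Real.cos (2 * π / 3) = -(1 / 2) := by
      rw [show 2 * π / 3 = π - π / 3 by ring, Real.cos_pi_sub, Real.cos_pi_div_three]
    rw [← h]
    exact Real.cos_le_cos_of_nonneg_of_le_pi (by linarith [ht.1]) (by linarith) ht.2
  · rw [← Real.cos_pi_div_three]
    exact Real.cos_le_cos_of_nonneg_of_le_pi (by linarith) (by linarith [ht.2]) ht.1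

/-- Because `cos t ≤ 1 / 2`, the right side is at least `w² - w + 1`, which exceeds the left side by
`3 (w - 1)² / 4`. -/
theorem arcKernel_denom_ge {t : ℝ} (ht : t ∈ Icc (π / 3) (2 * π / 3)) {w : ℝ} (hw : 0 ≤ w) :
    (1 + w) ^ 2 / 4 ≤ w ^ 2 - 2 * w * Real.cos t + 1 := by
  nlinarith [mul_le_mul_of_nonneg_left (cos_mem_of_mem_arc ht).2 hw, sq_nonneg (w - 1)]

theorem arcKernel_denom_pos {t : ℝ} (ht : t ∈ Icc (π / 3) (2 * π / 3)) {w : ℝ} (hw : 0 ≤ w) :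
    0 < w ^ 2 - 2 * w * Real.cos t + 1 :=
  lt_of_lt_of_le (by positivity) (arcKernel_denom_ge ht hw)

theorem arcKernel_nonneg {t : ℝ} (ht : t ∈ Icc (π / 3) (2 * π / 3)) {w : ℝ} (hw : 0 ≤ w) :
    0 ≤ arcKernel t w :=
  div_nonneg hw (arcKernel_denom_pos ht hw).le

theorem arcKernel_inv (t : ℝ) {w : ℝ} (hw : 0 < w) : arcKernel t w⁻¹ = arcKernel t w := by
  unfold arcKernel
  have h : (w⁻¹) ^ 2 - 2 * w⁻¹ * Real.cos t + 1 =
      (w ^ 2 - 2 * w * Real.cos t + 1) / w ^ 2 := by field_simp; ring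
  rw [h, div_div_eq_mul_div]
  congr 1
  field_simp

/-- The coordinate `w / (1 + w)` compactifies `[0, ∞)`, and long words contract in it. In the
difference of two kernel values `p - q` factors out, and the remaining quotient is bounded because
each denominator is comparable to `(1 + w)²`. -/
theorem arcKernel_lipschitz {t : ℝ} (ht : t ∈ Icc (π / 3) (2 * π / 3)) {p q : ℝ} (hp : 0 ≤ p)
    (hq : 0 ≤ q) :
    |arcKernel t p - arcKernel t q| ≤ 16 * |p / (1 + p) - q / (1 + q)| := by
  have hP := arcKernel_denom_ge ht hp
  have hQ := arcKernel_denom_ge ht hq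
  have hP0 := arcKernel_denom_pos ht hp
  have hQ0 := arcKernel_denom_pos ht hq
  unfold arcKernel
  set P := p ^ 2 - 2 * p * Real.cos t + 1 with hPd
  set Q := q ^ 2 - 2 * q * Real.cos t + 1 with hQd
  have e1 : p / P - q / Q = (p - q) * (1 - p * q) / (P * Q) := by
    rw [div_sub_div _ _ hP0.ne' hQ0.ne', hPd, hQd]; congr 1; ring
  have e2 : p / (1 + p) - q / (1 + q) = (p - q) / ((1 + p) * (1 + q)) := by
    field_simp; ring
  have h1 : |1 - p * q| ≤ (1 + p) * (1 + q) := by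
    rw [abs_le]; constructor <;> nlinarith [mul_nonneg hp hq]
  rw [e1, e2, abs_div, abs_div, abs_mul, abs_of_pos (mul_pos hP0 hQ0),
    abs_of_pos (show 0 < (1 + p) * (1 + q) by positivity), ← mul_div_assoc,
    div_le_div_iff₀ (mul_pos hP0 hQ0) (by positivity)]
  -- The constant 16 is the product of the two factors 4 in `arcKernel_denom_ge`.
  have h2 : ((1 + p) * (1 + q)) ^ 2 ≤ 16 * (P * Q) := by
    have := mul_le_mul hP hQ (by positivity) hP0.le
    nlinarith
  calc |p - q| * |1 - p * q| * ((1 + p) * (1 + q))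
      ≤ |p - q| * ((1 + p) * (1 + q)) * ((1 + p) * (1 + q)) := by gcongr
    _ = |p - q| * ((1 + p) * (1 + q)) ^ 2 := by ring
    _ ≤ |p - q| * (16 * (P * Q)) := by gcongr
    _ = 16 * |p - q| * (P * Q) := by ring

/-- The weight of the coboundary in the comparison with the golden ratio. -/
noncomputable def goldenWeight : ℝ := 1 / (2 + Real.goldenRatio)

theorem goldenWeight_nonneg : 0 ≤ goldenWeight :=
  div_nonneg zero_le_one (by linarith [Real.goldenRatio_pos])

theorem goldenWeight_le_one : goldenWeight ≤ 1 := by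
  unfold goldenWeight
  rw [div_le_one (by linarith [Real.goldenRatio_pos])]
  linarith [Real.goldenRatio_pos]

/-- The comparison with the golden ratio for the kernel with `cos t = 1 / 2`. -/
theorem golden_comparison_extreme (x : ℝ) :
    (1 - goldenWeight) * (x / (x ^ 2 - x + 1)) +
      goldenWeight * ((x - 1) / ((x - 1) ^ 2 - (x - 1) + 1)) ≤
    Real.goldenRatio / (Real.goldenRatio ^ 2 - Real.goldenRatio + 1) := by
  have hg := Real.goldenRatio_sq
  have hg0 := Real.goldenRatio_pos
  unfold goldenWeight
  set g := Real.goldenRatio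
  have h1 : 0 < x ^ 2 - x + 1 := by nlinarith [sq_nonneg (2 * x - 1)]
  have h2 : 0 < (x - 1) ^ 2 - (x - 1) + 1 := by nlinarith [sq_nonneg (2 * (x - 1) - 1)]
  rw [show g ^ 2 - g + 1 = 2 by rw [hg]; ring, ← sub_nonneg]
  -- The slack has a double zero at `g`. This forces the weight `l`: with `k(x) = x / (x² - x + 1)`,
  -- the relations `k(1/x) = k(x)` and `g - 1 = 1/g` give `k'(g - 1) = -g² k'(g)`, so `g` is
  -- critical exactly when `1 - l = l g²`, that is `l = 1 / (2 + g)`.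
  have e : g / 2 - ((1 - 1 / (2 + g)) * (x / (x ^ 2 - x + 1)) +
      1 / (2 + g) * ((x - 1) / ((x - 1) ^ 2 - (x - 1) + 1))) =
      (x - g) ^ 2 * ((3 * g + 1) * (x - 1) ^ 2 + g) /
        (2 * ((2 + g) * (x ^ 2 - x + 1) * ((x - 1) ^ 2 - (x - 1) + 1))) := by
    have h3 : 2 + g ≠ 0 := by positivity
    obtain ⟨P, hP⟩ : ∃ P, P = x ^ 2 - x + 1 := ⟨_, rfl⟩
    obtain ⟨Q, hQ⟩ : ∃ Q, Q = (x - 1) ^ 2 - (x - 1) + 1 := ⟨_, rfl⟩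
    rw [← hP] at h1 ⊢
    rw [← hQ] at h2 ⊢
    have h1' := h1.ne'
    have h2' := h2.ne'
    field_simp
    rw [hP, hQ]
    linear_combination (-(3 * (x - 1) ^ 2 + 1) * g +
      (x ^ 2 - x + 1) * ((x - 1) ^ 2 - (x - 1) + 1) - (x - 1) ^ 2 +
      (2 * x - 1) * (3 * (x - 1) ^ 2 + 1)) * hg
  rw [e]
  positivity

/-- The map `u ↦ u / (1 + d u)` is increasing and concave on `[0, ∞)`. The tangent line at `c` gives
both properties at once. -/
theorem jensen_mobius {l a b c d : ℝ} (hl0 : 0 ≤ l) (hl1 : l ≤ 1) (ha : 0 ≤ a) (hb : 0 ≤ b)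
    (hc : 0 ≤ c) (hd : 0 ≤ d) (h : (1 - l) * a + l * b ≤ c) :
    (1 - l) * (a / (1 + d * a)) + l * (b / (1 + d * b)) ≤ c / (1 + d * c) := by
  have tangent : ∀ u : ℝ, 0 ≤ u →
      u / (1 + d * u) ≤ c / (1 + d * c) + (u - c) / (1 + d * c) ^ 2 := by
    intro u hu
    have e : c / (1 + d * c) + (u - c) / (1 + d * c) ^ 2 - u / (1 + d * u) =
        d * (u - c) ^ 2 / ((1 + d * c) ^ 2 * (1 + d * u)) := by
      have h1 : 1 + d * c ≠ 0 := by positivity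
      have h2 : 1 + d * u ≠ 0 := by positivity
      field_simp
      ring
    have : 0 ≤ d * (u - c) ^ 2 / ((1 + d * c) ^ 2 * (1 + d * u)) := by positivity
    linarith
  have i1 := mul_le_mul_of_nonneg_left (tangent a ha) (sub_nonneg.2 hl1)
  have i2 := mul_le_mul_of_nonneg_left (tangent b hb) hl0
  have i3 : ((1 - l) * a + l * b - c) / (1 + d * c) ^ 2 ≤ 0 :=
    div_nonpos_of_nonpos_of_nonneg (by linarith) (by positivity)
  have e : (1 - l) * (c / (1 + d * c) + (a - c) / (1 + d * c) ^ 2) +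
      l * (c / (1 + d * c) + (b - c) / (1 + d * c) ^ 2) =
      c / (1 + d * c) + ((1 - l) * a + l * b - c) / (1 + d * c) ^ 2 := by ring
  linarith

/-- Passing from `cos t = 1 / 2` to a general `t` adds the constant `d = 1 - 2 cos t ≥ 0` to the
reciprocal of the kernel. The kernel is thus the image of the extreme one under `u ↦ u / (1 + d u)`,
and `jensen_mobius` transports the inequality. -/
theorem arcKernel_golden {t : ℝ} (ht : t ∈ Icc (π / 3) (2 * π / 3)) {x : ℝ} (hx : 1 ≤ x) :
    (1 - goldenWeight) * arcKernel t x + goldenWeight * arcKernel t (x - 1) ≤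
      arcKernel t Real.goldenRatio := by
  have key : ∀ w : ℝ, arcKernel t w = w / (w ^ 2 - w + 1) /
      (1 + (1 - 2 * Real.cos t) * (w / (w ^ 2 - w + 1))) := by
    intro w
    have h : w ^ 2 - w + 1 ≠ 0 := by nlinarith [sq_nonneg (2 * w - 1)]
    unfold arcKernel
    have e : 1 + (1 - 2 * Real.cos t) * (w / (w ^ 2 - w + 1)) =
        (w ^ 2 - 2 * w * Real.cos t + 1) / (w ^ 2 - w + 1) := by
      rw [eq_div_iff h, add_mul, mul_assoc, div_mul_cancel₀ _ h]; ring
    rw [e, div_div_div_cancel_right₀ h]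
  have pos : ∀ w : ℝ, 0 ≤ w → 0 ≤ w / (w ^ 2 - w + 1) := fun w hw =>
    div_nonneg hw (by nlinarith [sq_nonneg (2 * w - 1)])
  rw [key, key, key]
  exact jensen_mobius goldenWeight_nonneg goldenWeight_le_one (pos _ (by linarith))
    (pos _ (by linarith)) (pos _ Real.goldenRatio_pos.le)
    (by linarith [(cos_mem_of_mem_arc ht).2]) (golden_comparison_extreme x)

/-! ### The potential -/

/-- The properties of the potential `w ↦ ∫ g(t) w / (w² - 2 w cos t + 1) dt` that control its sums
along orbits of the Farey map. -/
structure IsFareyPotential (K : ℝ → ℝ) (L : ℝ) : Prop where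
  nonneg : ∀ w, 0 ≤ w → 0 ≤ K w
  zero : K 0 = 0
  inv : ∀ w, 0 < w → K w⁻¹ = K w
  golden : ∀ x, 1 ≤ x →
    (1 - goldenWeight) * K x + goldenWeight * K (x - 1) ≤ K Real.goldenRatio
  lipschitz : ∀ p q, 0 ≤ p → 0 ≤ q → |K p - K q| ≤ L * |p / (1 + p) - q / (1 + q)|

/-- The potential with weight `g` on the arc. -/
noncomputable def arcPotential (g : ℝ → ℝ) (w : ℝ) : ℝ :=
  ∫ t in (π / 3)..(2 * π / 3), g t * arcKernel t w

theorem pi_div_three_le : π / 3 ≤ 2 * π / 3 := by linarith [Real.pi_pos]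

theorem continuousOn_arcKernel {w : ℝ} (hw : 0 ≤ w) :
    ContinuousOn (fun t => arcKernel t w) (Icc (π / 3) (2 * π / 3)) := by
  unfold arcKernel
  exact continuousOn_const.div (by fun_prop) fun t ht => (arcKernel_denom_pos ht hw).ne'

theorem intervalIntegrable_arc {g : ℝ → ℝ} (hg : ContinuousOn g (Icc (π / 3) (2 * π / 3))) :
    IntervalIntegrable g MeasureTheory.volume (π / 3) (2 * π / 3) :=
  ContinuousOn.intervalIntegrable (by rwa [uIcc_of_le pi_div_three_le])

theorem isFareyPotential_arcPotential {g : ℝ → ℝ}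
    (hg : ContinuousOn g (Icc (π / 3) (2 * π / 3)))
    (hg0 : ∀ t ∈ Icc (π / 3) (2 * π / 3), 0 ≤ g t) :
    IsFareyPotential (arcPotential g) (16 * ∫ t in (π / 3)..(2 * π / 3), g t) where
  nonneg w hw := intervalIntegral.integral_nonneg pi_div_three_le fun t ht =>
    mul_nonneg (hg0 t ht) (arcKernel_nonneg ht hw)
  zero := by simp [arcPotential, arcKernel]
  inv w hw := by simp only [arcPotential, arcKernel_inv _ hw]
  golden x hx := by
    have hi : ∀ w, 0 ≤ w → IntervalIntegrable (fun t => g t * arcKernel t w)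
        MeasureTheory.volume (π / 3) (2 * π / 3) := fun w hw =>
      intervalIntegrable_arc (hg.mul (continuousOn_arcKernel hw))
    unfold arcPotential
    rw [← intervalIntegral.integral_const_mul, ← intervalIntegral.integral_const_mul,
      ← intervalIntegral.integral_add ((hi x (by linarith)).const_mul _)
        ((hi (x - 1) (by linarith)).const_mul _)]
    refine intervalIntegral.integral_mono_on pi_div_three_le
      (((hi x (by linarith)).const_mul _).add ((hi (x - 1) (by linarith)).const_mul _))
      (hi _ Real.goldenRatio_pos.le) fun t ht => ?_
    have := mul_le_mul_of_nonneg_left (arcKernel_golden ht hx) (hg0 t ht)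
    linarith
  lipschitz p q hp hq := by
    have hi : ∀ w, 0 ≤ w → IntervalIntegrable (fun t => g t * arcKernel t w)
        MeasureTheory.volume (π / 3) (2 * π / 3) := fun w hw =>
      intervalIntegrable_arc (hg.mul (continuousOn_arcKernel hw))
    unfold arcPotential
    rw [← intervalIntegral.integral_sub (hi p hp) (hi q hq)]
    refine (intervalIntegral.abs_integral_le_integral_abs pi_div_three_le).trans ?_
    rw [mul_assoc, mul_comm (∫ t in (π / 3)..(2 * π / 3), g t), ← mul_assoc,
      ← intervalIntegral.integral_const_mul]
    refine intervalIntegral.integral_mono_on pi_div_three_le ((hi p hp).sub (hi q hq)).abs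
      ((intervalIntegrable_arc hg).const_mul _) fun t ht => ?_
    rw [← mul_sub, abs_mul, abs_of_nonneg (hg0 t ht), mul_comm]
    exact mul_le_mul_of_nonneg_right (arcKernel_lipschitz ht hp hq) (hg0 t ht)

/-! ### Words in `T` and `V` -/

/-- The letter `T` (for `true`) or `V` (for `false`). -/
def letter (b : Bool) : SL(2, ℤ) := if b then T else V

/-- The product of the letters of a word. -/
def wordMatrix (l : List Bool) : SL(2, ℤ) := (l.map letter).prod

/-- The action of a letter on the real line. -/
noncomputable def letterEval (b : Bool) (p : ℝ) : ℝ := if b then p + 1 else p / (p + 1)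

/-- The action of a word on the real line. -/
noncomputable def wordEval (l : List Bool) (p : ℝ) : ℝ := l.foldr letterEval p

/-- The sum of `K` along the orbit of a word: the sum of `K (wordEval l' p)` over the non-empty
suffixes `l'` of `l`. -/
noncomputable def wordSum (K : ℝ → ℝ) : List Bool → ℝ → ℝ
  | [], _ => 0
  | b :: l, p => K (wordEval (b :: l) p) + wordSum K l p

@[simp] theorem wordMatrix_nil : wordMatrix [] = 1 := rfl

@[simp] theorem wordMatrix_cons (b : Bool) (l : List Bool) :
    wordMatrix (b :: l) = letter b * wordMatrix l := by simp [wordMatrix]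

@[simp] theorem wordMatrix_append (l l' : List Bool) :
    wordMatrix (l ++ l') = wordMatrix l * wordMatrix l' := by simp [wordMatrix]

@[simp] theorem wordEval_nil (p : ℝ) : wordEval [] p = p := rfl

@[simp] theorem wordEval_cons (b : Bool) (l : List Bool) (p : ℝ) :
    wordEval (b :: l) p = letterEval b (wordEval l p) := rfl

@[simp] theorem wordEval_append (l l' : List Bool) (p : ℝ) :
    wordEval (l ++ l') p = wordEval l (wordEval l' p) := by simp [wordEval]

theorem letterEval_nonneg (b : Bool) {p : ℝ} (hp : 0 ≤ p) : 0 ≤ letterEval b p := by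
  cases b <;> simp only [letterEval] <;> norm_num <;> positivity

theorem letterEval_pos (b : Bool) {p : ℝ} (hp : 0 < p) : 0 < letterEval b p := by
  cases b <;> simp only [letterEval] <;> norm_num <;> positivity

theorem wordEval_nonneg (l : List Bool) {p : ℝ} (hp : 0 ≤ p) : 0 ≤ wordEval l p := by
  induction l with
  | nil => exact hp
  | cons b l ih => exact letterEval_nonneg b ih

theorem wordEval_pos (l : List Bool) {p : ℝ} (hp : 0 < p) : 0 < wordEval l p := by
  induction l with
  | nil => exact hp
  | cons b l ih => exact letterEval_pos b ih

theorem wordSum_append (K : ℝ → ℝ) (l l' : List Bool) (p : ℝ) :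
    wordSum K (l ++ l') p = wordSum K l (wordEval l' p) + wordSum K l' p := by
  induction l with
  | nil => simp [wordSum]
  | cons b l ih => simp only [List.cons_append, wordSum, ih, wordEval_cons, wordEval_append]; ring

theorem letter_mul_apply (b : Bool) (A : SL(2, ℤ)) :
    (letter b * A) 0 0 = (if b then A 0 0 + A 1 0 else A 0 0) ∧
    (letter b * A) 0 1 = (if b then A 0 1 + A 1 1 else A 0 1) ∧
    (letter b * A) 1 0 = (if b then A 1 0 else A 0 0 + A 1 0) ∧
    (letter b * A) 1 1 = (if b then A 1 1 else A 0 1 + A 1 1) := by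
  have hT : T.1 = !![1, 1; 0, 1] := rfl
  have hV : V.1 = !![1, 0; 1, 1] := rfl
  cases b <;>
  simp [letter, Matrix.SpecialLinearGroup.coe_mul, hT, hV, Matrix.mul_apply, Fin.sum_univ_two]

theorem mul_letter_apply (b : Bool) (A : SL(2, ℤ)) :
    (A * letter b) 0 0 = (if b then A 0 0 else A 0 0 + A 0 1) ∧
    (A * letter b) 0 1 = (if b then A 0 0 + A 0 1 else A 0 1) ∧
    (A * letter b) 1 0 = (if b then A 1 0 else A 1 0 + A 1 1) ∧
    (A * letter b) 1 1 = (if b then A 1 0 + A 1 1 else A 1 1) := by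
  cases b
  · exact mul_V_apply A
  · exact mul_T_apply A

/-- Each letter adds one row to the other, hence at least 1 to the sum of the entries. Linear growth
is all that holds in general: the powers of `V` give equality. -/
theorem wordMatrix_bounds (l : List Bool) :
    1 ≤ wordMatrix l 0 0 ∧ 0 ≤ wordMatrix l 0 1 ∧ 0 ≤ wordMatrix l 1 0 ∧ 1 ≤ wordMatrix l 1 1 ∧
    (l.length : ℤ) + 2 ≤
      wordMatrix l 0 0 + wordMatrix l 0 1 + wordMatrix l 1 0 + wordMatrix l 1 1 := by
  induction l with
  | nil => simp
  | cons b l ih =>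
    obtain ⟨h1, h2, h3, h4, h5⟩ := ih
    obtain ⟨e1, e2, e3, e4⟩ := letter_mul_apply b (wordMatrix l)
    rw [wordMatrix_cons, e1, e2, e3, e4, List.length_cons]
    cases b <;> simp only [if_true, if_false, Bool.false_eq_true] <;> push_cast <;> omega

theorem wordMatrix_bounds_real (l : List Bool) :
    (1 : ℝ) ≤ wordMatrix l 0 0 ∧ (0 : ℝ) ≤ wordMatrix l 0 1 ∧ (0 : ℝ) ≤ wordMatrix l 1 0 ∧
    (1 : ℝ) ≤ wordMatrix l 1 1 ∧ (l.length : ℝ) + 2 ≤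
      wordMatrix l 0 0 + wordMatrix l 0 1 + wordMatrix l 1 0 + wordMatrix l 1 1 := by
  obtain ⟨h1, h2, h3, h4, h5⟩ := wordMatrix_bounds l
  exact ⟨by exact_mod_cast h1, by exact_mod_cast h2, by exact_mod_cast h3, by exact_mod_cast h4,
    by exact_mod_cast h5⟩

theorem det_real (A : SL(2, ℤ)) : (A 0 0 : ℝ) * A 1 1 - A 0 1 * A 1 0 = 1 := by
  have := A.2
  rw [Matrix.det_fin_two] at this
  exact_mod_cast this

theorem wordEval_eq (l : List Bool) {p : ℝ} (hp : 0 ≤ p) :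
    wordEval l p = ((wordMatrix l 0 0 : ℝ) * p + wordMatrix l 0 1) /
      ((wordMatrix l 1 0 : ℝ) * p + wordMatrix l 1 1) := by
  induction l with
  | nil => simp
  | cons b l ih =>
    obtain ⟨h1, h2, h3, h4, -⟩ := wordMatrix_bounds_real l
    obtain ⟨e1, e2, e3, e4⟩ := letter_mul_apply b (wordMatrix l)
    rw [wordEval_cons, ih, wordMatrix_cons, e1, e2, e3, e4]
    have hd : (0 : ℝ) < (wordMatrix l 1 0 : ℝ) * p + wordMatrix l 1 1 := by positivity
    cases b
    · simp only [letterEval, if_false, Bool.false_eq_true]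
      rw [div_add_one hd.ne', div_div_div_cancel_right₀ hd.ne']
      push_cast; congr 1; ring
    · simp only [letterEval, if_true]
      rw [div_add_one hd.ne']
      push_cast; congr 1; ring

/-- The entries of the product of the reversed word. -/
theorem wordMatrix_reverse (l : List Bool) :
    wordMatrix l.reverse 0 0 = wordMatrix l 1 1 ∧ wordMatrix l.reverse 0 1 = wordMatrix l 0 1 ∧
    wordMatrix l.reverse 1 0 = wordMatrix l 1 0 ∧ wordMatrix l.reverse 1 1 = wordMatrix l 0 0 := by
  induction l with
  | nil => simp
  | cons b l ih =>
    obtain ⟨h1, h2, h3, h4⟩ := ih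
    obtain ⟨e1, e2, e3, e4⟩ := letter_mul_apply b (wordMatrix l)
    obtain ⟨m1, m2, m3, m4⟩ := mul_letter_apply b (wordMatrix l.reverse)
    have : wordMatrix (b :: l).reverse = wordMatrix l.reverse * letter b := by simp
    rw [this, wordMatrix_cons, e1, e2, e3, e4, m1, m2, m3, m4, h1, h2, h3, h4]
    cases b <;> simp [add_comm]

/-! ### Distortion -/

/-- Two points have close images under a long word. -/
theorem wordEval_distortion (l : List Bool) {p q : ℝ} (hp : 0 ≤ p) (hq : 0 ≤ q) :
    |wordEval l p / (1 + wordEval l p) - wordEval l q / (1 + wordEval l q)| ≤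
      1 / ((l.length : ℝ) + 1) := by
  obtain ⟨h1, h2, h3, h4, h5⟩ := wordMatrix_bounds_real l
  have hdet := det_real (wordMatrix l)
  rw [wordEval_eq l hp, wordEval_eq l hq]
  generalize (wordMatrix l 0 0 : ℝ) = α at *
  generalize (wordMatrix l 0 1 : ℝ) = β at *
  generalize (wordMatrix l 1 0 : ℝ) = γ at *
  generalize (wordMatrix l 1 1 : ℝ) = δ at *
  have key : ∀ x : ℝ, 0 ≤ x → (α * x + β) / (γ * x + δ) / (1 + (α * x + β) / (γ * x + δ)) =
      (α * x + β) / ((α + γ) * x + (β + δ)) := by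
    intro x hx
    have hd : γ * x + δ ≠ 0 := by positivity
    rw [one_add_div hd, div_div_div_cancel_right₀ hd]
    congr 1; ring
  have hP : 0 < (α + γ) * p + (β + δ) := by positivity
  have hQ : 0 < (α + γ) * q + (β + δ) := by positivity
  rw [key p hp, key q hq, div_sub_div _ _ hP.ne' hQ.ne', abs_div, abs_of_pos (mul_pos hP hQ),
    div_le_div_iff₀ (mul_pos hP hQ) (by positivity), one_mul,
    show (α * p + β) * ((α + γ) * q + (β + δ)) - ((α + γ) * p + (β + δ)) * (α * q + β) =
      p - q by linear_combination (p - q) * hdet]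
  have i1 : |p - q| ≤ p + q := by rw [abs_le]; constructor <;> linarith
  -- For `u, v ≥ 1` one has `u v ≥ u + v - 1`; here `u + v` is the sum of all entries.
  have i2 : (l.length : ℝ) + 1 ≤ (α + γ) * (β + δ) := by
    nlinarith [mul_nonneg (show 0 ≤ α + γ - 1 by linarith) (show 0 ≤ β + δ - 1 by linarith)]
  calc |p - q| * ((l.length : ℝ) + 1) ≤ (p + q) * ((α + γ) * (β + δ)) := by gcongr
    _ ≤ ((α + γ) * p + (β + δ)) * ((α + γ) * q + (β + δ)) := by
      nlinarith [mul_nonneg hp hq, mul_nonneg (mul_nonneg hp hq) (sq_nonneg (α + γ)),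
        sq_nonneg (β + δ)]

/-- The harmonic sum `1 + 1/2 + ⋯ + 1/n`. -/
noncomputable def harmonicSum (n : ℕ) : ℝ := ∑ i ∈ Finset.range n, 1 / ((i : ℝ) + 1)

theorem harmonicSum_mono {m n : ℕ} (h : m ≤ n) : harmonicSum m ≤ harmonicSum n :=
  Finset.sum_le_sum_of_subset_of_nonneg (Finset.range_mono h) fun _ _ _ => by positivity

theorem harmonicSum_nonneg (n : ℕ) : 0 ≤ harmonicSum n :=
  Finset.sum_nonneg fun _ _ => by positivity

theorem tendsto_harmonicSum_div : Tendsto (fun n : ℕ => harmonicSum n / n) atTop (𝓝 0) := by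
  simpa [harmonicSum, div_eq_inv_mul] using
    (tendsto_one_div_add_atTop_nhds_zero_nat (𝕜 := ℝ)).cesaro

/-! ### Sums of a potential along orbits -/

section Potential

variable {K : ℝ → ℝ} {L : ℝ}

theorem IsFareyPotential.lipschitz_nonneg (hK : IsFareyPotential K L) : 0 ≤ L := by
  have := (abs_nonneg _).trans (hK.lipschitz 1 0 zero_le_one le_rfl)
  norm_num at this
  linarith

/-- A suffix of length `k` brings the two orbits within `1 / (k + 1)` of each other, which is
weakened to `1 / k`. Summing over the non-empty suffixes gives the harmonic sum, whatever the
starting points. -/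
theorem wordSum_distortion (hK : IsFareyPotential K L) (l : List Bool) {p q : ℝ} (hp : 0 ≤ p)
    (hq : 0 ≤ q) : |wordSum K l p - wordSum K l q| ≤ L * harmonicSum l.length := by
  induction l with
  | nil => simp [wordSum, harmonicSum]
  | cons b l ih =>
    have h1 := hK.lipschitz _ _ (wordEval_nonneg (b :: l) hp) (wordEval_nonneg (b :: l) hq)
    have h2 := mul_le_mul_of_nonneg_left (wordEval_distortion (b :: l) hp hq) hK.lipschitz_nonneg
    have h3 : (1 : ℝ) / (((b :: l).length : ℝ) + 1) ≤ 1 / ((l.length : ℝ) + 1) := by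
      apply one_div_le_one_div_of_le (by positivity)
      rw [List.length_cons]; push_cast; linarith
    have h4 := mul_le_mul_of_nonneg_left h3 hK.lipschitz_nonneg
    have h5 : harmonicSum (b :: l).length = harmonicSum l.length + 1 / ((l.length : ℝ) + 1) := by
      rw [List.length_cons, harmonicSum, Finset.sum_range_succ, harmonicSum]
    rw [h5, mul_add]
    calc |wordSum K (b :: l) p - wordSum K (b :: l) q|
        = |(wordSum K l p - wordSum K l q) +
            (K (wordEval (b :: l) p) - K (wordEval (b :: l) q))| := by
          simp only [wordSum]; congr 1; ring
      _ ≤ _ := (abs_add_le _ _).trans (by linarith)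

theorem wordSum_nonneg (hK : IsFareyPotential K L) (l : List Bool) {p : ℝ} (hp : 0 ≤ p) :
    0 ≤ wordSum K l p := by
  induction l with
  | nil => exact le_rfl
  | cons b l ih => exact add_nonneg (hK.nonneg _ (wordEval_nonneg _ hp)) ih

/-- For `T` this is `golden` at `x = p + 1`. Inversion conjugates `V` to `T` and preserves `K`, so
for `V` it is `golden` at `x = 1/p + 1`. -/
theorem potential_letter_le (hK : IsFareyPotential K L) (b : Bool) {p : ℝ} (hp : 0 < p) :
    (1 - goldenWeight) * K (letterEval b p) + goldenWeight * K p ≤ K Real.goldenRatio := by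
  cases b
  · have h := hK.golden (p⁻¹ + 1) (by have := inv_pos.2 hp; linarith)
    have e : letterEval false p = (p⁻¹ + 1)⁻¹ := by
      simp only [letterEval, Bool.false_eq_true, if_false]
      field_simp
      ring
    rw [add_sub_cancel_right, hK.inv p hp] at h
    rwa [e, hK.inv _ (by positivity)]
  · have h := hK.golden (p + 1) (by linarith)
    rw [add_sub_cancel_right] at h
    simpa [letterEval] using h

/-- By `potential_letter_le`, each letter costs at most `K φ` plus `goldenWeight` times the
increment of `K` along the orbit; the increments telescope. -/
theorem wordSum_le (hK : IsFareyPotential K L) (l : List Bool) {p : ℝ} (hp : 0 < p) :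
    wordSum K l p ≤ l.length * K Real.goldenRatio +
      goldenWeight * (K (wordEval l p) - K p) := by
  induction l with
  | nil => simp [wordSum]
  | cons b l ih =>
    have := potential_letter_le hK b (wordEval_pos l hp)
    simp only [wordSum, wordEval_cons, List.length_cons]
    push_cast
    linarith

/-- Along a periodic orbit, the average of `K` is at most its value at the golden ratio. -/
theorem wordSum_le_of_fixed (hK : IsFareyPotential K L) (l : List Bool) {p : ℝ} (hp : 0 < p)
    (hfix : wordEval l p = p) : wordSum K l p ≤ l.length * K Real.goldenRatio := by
  have := wordSum_le hK l hp
  rwa [hfix, sub_self, mul_zero, add_zero] at this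

/-! ### The two-sided sum -/

/-- The sum of `K` along the forward and the backward orbit of a word. -/
noncomputable def twoSidedSum (K : ℝ → ℝ) (l : List Bool) : ℝ :=
  wordSum K l 1 + wordSum K l.reverse 1

/-- This replaces the fixed points of a word, which depend on the whole word, by the common base
point 1. -/
theorem twoSidedSum_close (hK : IsFareyPotential K L) (l : List Bool) {p r : ℝ} (hp : 0 ≤ p)
    (hr : 0 ≤ r) : |wordSum K l p + wordSum K l.reverse r - twoSidedSum K l| ≤
      2 * L * harmonicSum l.length := by
  have h1 := wordSum_distortion hK l hp zero_le_one
  have h2 := wordSum_distortion hK l.reverse hr zero_le_one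
  rw [List.length_reverse] at h2
  unfold twoSidedSum
  rw [abs_le] at *
  constructor <;> linarith [h1.1, h1.2, h2.1, h2.2]

/-- Concatenation changes only two base points: `l` now starts at the image of 1 under `l'`, and
`l'.reverse` at the image of 1 under `l.reverse`. Distortion bounds the effect of both. -/
theorem twoSidedSum_append (hK : IsFareyPotential K L) (l l' : List Bool) :
    |twoSidedSum K (l ++ l') - twoSidedSum K l - twoSidedSum K l'| ≤
      2 * L * harmonicSum (l ++ l').length := by
  have h1 := wordSum_distortion hK l (wordEval_nonneg l' zero_le_one) zero_le_one
  have h2 := wordSum_distortion hK l'.reverse (wordEval_nonneg l.reverse zero_le_one) zero_le_one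
  have m1 := mul_le_mul_of_nonneg_left
    (harmonicSum_mono (show l.length ≤ (l ++ l').length by simp)) hK.lipschitz_nonneg
  have m2 := mul_le_mul_of_nonneg_left
    (harmonicSum_mono (show l'.length ≤ (l ++ l').length by simp)) hK.lipschitz_nonneg
  rw [List.length_reverse] at h2
  unfold twoSidedSum
  rw [List.reverse_append, wordSum_append, wordSum_append]
  rw [abs_le] at *
  constructor <;> linarith [h1.1, h1.2, h2.1, h2.2]

theorem wordEval_replicate_false_zero (m : ℕ) : wordEval (List.replicate m false) 0 = 0 := by
  induction m with
  | zero => rfl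
  | succ m ih => rw [List.replicate_succ, wordEval_cons, ih]; simp [letterEval]

theorem wordSum_replicate_false_zero (hK : IsFareyPotential K L) (m : ℕ) :
    wordSum K (List.replicate m false) 0 = 0 := by
  induction m with
  | zero => rfl
  | succ m ih =>
    rw [List.replicate_succ, wordSum, ih, ← List.replicate_succ, wordEval_replicate_false_zero,
      hK.zero, add_zero]

/-- `V` fixes 0 and `K 0 = 0`, so the orbit sums from base point 0 vanish; only the distortion
remains. -/
theorem twoSidedSum_replicate_false_le (hK : IsFareyPotential K L) (m : ℕ) :
    twoSidedSum K (List.replicate m false) ≤ 2 * L * harmonicSum m := by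
  have h := twoSidedSum_close hK (List.replicate m false) (le_refl (0 : ℝ)) (le_refl (0 : ℝ))
  rw [List.reverse_replicate, wordSum_replicate_false_zero hK, List.length_replicate, abs_le] at h
  linarith [h.1]

/-- The word `TVTV⋯TV` of length `2 m`. -/
def goldenWord : ℕ → List Bool
  | 0 => []
  | m + 1 => true :: false :: goldenWord m

theorem goldenWord_length (m : ℕ) : (goldenWord m).length = 2 * m := by
  induction m with
  | zero => rfl
  | succ m ih => simp only [goldenWord, List.length_cons, ih]; ring

theorem goldenWord_succ' (m : ℕ) : goldenWord (m + 1) = goldenWord m ++ [true, false] := by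
  induction m with
  | zero => rfl
  | succ m ih => exact congrArg (fun l => true :: false :: l) ih

theorem letterEval_false_golden : letterEval false Real.goldenRatio = Real.goldenRatio⁻¹ := by
  have h0 := Real.goldenRatio_pos
  have := Real.goldenRatio_sq
  simp only [letterEval, Bool.false_eq_true, if_false]
  rw [div_eq_iff (by positivity), ← this]
  field_simp

theorem letterEval_true_golden_inv :
    letterEval true Real.goldenRatio⁻¹ = Real.goldenRatio := by
  have h0 := Real.goldenRatio_pos
  have := Real.goldenRatio_sq
  simp only [letterEval, if_true]
  rw [inv_eq_one_div, div_add_one h0.ne', div_eq_iff h0.ne']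
  linarith

theorem wordEval_goldenWord (m : ℕ) :
    wordEval (goldenWord m) Real.goldenRatio = Real.goldenRatio := by
  induction m with
  | zero => rfl
  | succ m ih =>
    rw [goldenWord, wordEval_cons, wordEval_cons, ih, letterEval_false_golden,
      letterEval_true_golden_inv]

theorem wordSum_goldenWord (hK : IsFareyPotential K L) (m : ℕ) :
    wordSum K (goldenWord m) Real.goldenRatio = 2 * m * K Real.goldenRatio := by
  induction m with
  | zero => simp [goldenWord, wordSum]
  | succ m ih =>
    simp only [goldenWord, wordSum, wordEval_cons, wordEval_goldenWord, letterEval_false_golden,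
      letterEval_true_golden_inv, ih, hK.inv _ Real.goldenRatio_pos]
    push_cast; ring

theorem wordEval_reverse_goldenWord (m : ℕ) :
    wordEval (goldenWord m).reverse Real.goldenRatio⁻¹ = Real.goldenRatio⁻¹ := by
  induction m with
  | zero => rfl
  | succ m ih =>
    rw [goldenWord_succ', List.reverse_append]
    simp only [List.reverse_cons, List.reverse_nil, List.nil_append, List.cons_append,
      wordEval_cons, ih, letterEval_false_golden, letterEval_true_golden_inv]

theorem wordSum_reverse_goldenWord (hK : IsFareyPotential K L) (m : ℕ) :
    wordSum K (goldenWord m).reverse Real.goldenRatio⁻¹ = 2 * m * K Real.goldenRatio := by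
  induction m with
  | zero => simp [goldenWord, wordSum]
  | succ m ih =>
    rw [goldenWord_succ', List.reverse_append]
    simp only [List.reverse_cons, List.reverse_nil, List.nil_append, List.cons_append, wordSum,
      wordEval_cons, wordEval_reverse_goldenWord, letterEval_false_golden,
      letterEval_true_golden_inv, ih, hK.inv _ Real.goldenRatio_pos]
    push_cast; ring

/-- The word fixes `φ` and its reverse fixes `φ⁻¹`; both orbits alternate between `φ` and `φ⁻¹`,
where `K` takes the same value. -/
theorem twoSidedSum_goldenWord_ge (hK : IsFareyPotential K L) (m : ℕ) :
    4 * m * K Real.goldenRatio - 2 * L * harmonicSum (2 * m) ≤ twoSidedSum K (goldenWord m) := by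
  have h := twoSidedSum_close hK (goldenWord m) Real.goldenRatio_pos.le
    (inv_nonneg.2 Real.goldenRatio_pos.le)
  rw [wordSum_goldenWord hK, wordSum_reverse_goldenWord hK, goldenWord_length, abs_le] at h
  linarith [h.2]

end Potential

/-! ### Farey paths as words -/

theorem fareyFraction_wordMatrix (l : List Bool) :
    fareyFraction (wordMatrix l) = wordEval l 1 := by
  rw [wordEval_eq l zero_le_one]; simp [fareyFraction]

theorem wordEval_lt_wordEval (l : List Bool) {p q : ℝ} (hp : 0 ≤ p) (h : p < q) :
    wordEval l p < wordEval l q := by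
  obtain ⟨h1, h2, h3, h4, -⟩ := wordMatrix_bounds_real l
  have hq := hp.trans h.le
  rw [wordEval_eq l hp, wordEval_eq l hq, div_lt_div_iff₀ (by positivity) (by positivity)]
  linarith [congrArg (fun z => z * (q - p)) (det_real (wordMatrix l))]

theorem wordEval_le_wordEval (l : List Bool) {p q : ℝ} (hp : 0 ≤ p) (h : p ≤ q) :
    wordEval l p ≤ wordEval l q := by
  rcases h.eq_or_lt with rfl | h
  · exact le_rfl
  · exact (wordEval_lt_wordEval l hp h).le

/-- The Farey path of the image of a non-negative number under a word begins with that word. -/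
theorem fareyMatrix_wordEval (l : List Bool) {p : ℝ} (hp : 0 ≤ p) :
    fareyMatrix (wordEval l p) l.length = wordMatrix l := by
  induction l using List.reverseRecOn generalizing p with
  | nil => rfl
  | append_singleton l b ih =>
    have ih' := ih (letterEval_nonneg b hp)
    rw [wordEval_append, wordEval_cons, wordEval_nil, List.length_append, List.length_singleton,
      wordMatrix_append, wordMatrix_cons, wordMatrix_nil, mul_one, fareyMatrix, ih',
      fareyFraction_wordMatrix]
    -- `V` maps `[0, ∞)` into `[0, 1)` and `T` maps it into `[1, ∞)`. The value 1 itself belongs to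
    -- `T`, in agreement with the strict inequality that selects `V` in `fareyMatrix`.
    cases b
    · rw [if_pos]
      · rfl
      · apply wordEval_lt_wordEval l (letterEval_nonneg _ hp)
        simp only [letterEval, Bool.false_eq_true, if_false]
        rw [div_lt_one (by linarith)]
        linarith
    · rw [if_neg]
      · rfl
      · apply not_lt.2
        apply wordEval_le_wordEval l zero_le_one
        simp only [letterEval, if_true]
        linarith

theorem exists_word_fareyMatrix (x : ℝ) (n : ℕ) :
    ∃ l : List Bool, l.length = n ∧ fareyMatrix x n = wordMatrix l := by
  induction n with
  | zero => exact ⟨[], rfl, rfl⟩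
  | succ n ih =>
    obtain ⟨l, hl, e⟩ := ih
    rcases fareyMatrix_step x n with ⟨-, h⟩ | ⟨-, h⟩
    · exact ⟨l ++ [false], by simp [hl], by rw [h, e]; simp [letter]⟩
    · exact ⟨l ++ [true], by simp [hl], by rw [h, e]; simp [letter]⟩

/-! ### Primitives on the upper half plane -/

/-- A holomorphic function on the upper half plane has a primitive. -/
theorem exists_primitive_upperHalfPlane {g : ℂ → ℂ} (hg : DifferentiableOn ℂ g {z | 0 < z.im}) :
    ∃ F : ℂ → ℂ, ∀ z : ℂ, 0 < z.im → HasDerivAt F (g z) z := by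
  -- The Cayley transform carries `g(z) dz` to the unit disc, where `isExactOn_ball` gives a
  -- primitive; `2i / (1 - u)²` is the derivative of the inverse transform.
  have ball_ne : ∀ u ∈ Metric.ball (0 : ℂ) 1, 1 - u ≠ 0 := by
    intro u hu h
    rw [mem_ball_zero_iff, ← sub_eq_zero.1 h, norm_one] at hu
    exact lt_irrefl _ hu
  have him : ∀ u ∈ Metric.ball (0 : ℂ) 1, 0 < (Complex.I * (1 + u) / (1 - u)).im := by
    intro u hu
    have hn : 0 < Complex.normSq (1 - u) := Complex.normSq_pos.2 (ball_ne u hu)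
    rw [mem_ball_zero_iff, ← sq_lt_one_iff₀ (norm_nonneg _), ← Complex.normSq_eq_norm_sq,
      Complex.normSq_apply] at hu
    rw [Complex.div_im, div_sub_div_same]
    apply div_pos _ hn
    simp
    nlinarith
  have hder : ∀ u ∈ Metric.ball (0 : ℂ) 1,
      HasDerivAt (fun u => Complex.I * (1 + u) / (1 - u)) (2 * Complex.I / (1 - u) ^ 2) u := by
    intro u hu
    have h := (((hasDerivAt_id u).const_add 1).const_mul Complex.I).div
      ((hasDerivAt_id u).const_sub 1) (ball_ne u hu)
    refine h.congr_deriv ?_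
    simp only [id]
    congr 1; ring
  have hd : DifferentiableOn ℂ
      (fun u => g (Complex.I * (1 + u) / (1 - u)) * (2 * Complex.I / (1 - u) ^ 2))
      (Metric.ball (0 : ℂ) 1) := by
    apply DifferentiableOn.mul
    · exact hg.comp (fun u hu => (hder u hu).differentiableAt.differentiableWithinAt) him
    · exact (differentiableOn_const _).div (by fun_prop) fun u hu => pow_ne_zero 2 (ball_ne u hu)
  obtain ⟨G, hG⟩ := hd.isExactOn_ball
  refine ⟨fun z => G ((z - Complex.I) / (z + Complex.I)), fun z hz => ?_⟩
  have hz0 : z + Complex.I ≠ 0 := by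
    intro h
    have := congrArg Complex.im h
    simp at this
    linarith
  have hmem : (z - Complex.I) / (z + Complex.I) ∈ Metric.ball (0 : ℂ) 1 := by
    rw [mem_ball_zero_iff, norm_div, div_lt_one (norm_pos_iff.2 hz0),
      ← sq_lt_sq₀ (norm_nonneg _) (norm_nonneg _), ← Complex.normSq_eq_norm_sq,
      ← Complex.normSq_eq_norm_sq, Complex.normSq_apply, Complex.normSq_apply]
    simp
    nlinarith
  have h1 : HasDerivAt (fun z : ℂ => (z - Complex.I) / (z + Complex.I))
      (2 * Complex.I / (z + Complex.I) ^ 2) z := by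
    have h := ((hasDerivAt_id z).sub_const Complex.I).div
      ((hasDerivAt_id z).add_const Complex.I) hz0
    refine h.congr_deriv ?_
    simp only [id]
    congr 1; ring
  have e : 1 - (z - Complex.I) / (z + Complex.I) = 2 * Complex.I / (z + Complex.I) := by
    field_simp; ring
  have e' : Complex.I * (1 + (z - Complex.I) / (z + Complex.I)) /
      (1 - (z - Complex.I) / (z + Complex.I)) = z := by
    have hI := Complex.I_ne_zero
    rw [e]; field_simp; ring
  have h2 := (hG _ hmem).comp z h1
  refine h2.congr_deriv ?_
  beta_reduce
  rw [e', e]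
  have hI := Complex.I_ne_zero
  field_simp

/-! ### The forms `(1 / (z + r) - 1 / (z - p)) h(z) dz` -/

/-- The action of a letter on the complex plane. -/
noncomputable def letterMap (b : Bool) (z : ℂ) : ℂ := if b then z + 1 else z / (z + 1)

/-- The action of a word on the complex plane. -/
noncomputable def wordMap (l : List Bool) (z : ℂ) : ℂ := l.foldr letterMap z

@[simp] theorem wordMap_nil (z : ℂ) : wordMap [] z = z := rfl

@[simp] theorem wordMap_cons (b : Bool) (l : List Bool) (z : ℂ) :
    wordMap (b :: l) z = letterMap b (wordMap l z) := rfl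

theorem add_ofReal_ne_zero {z : ℂ} (hz : 0 < z.im) (r : ℝ) : z + r ≠ 0 := by
  intro h
  have := congrArg Complex.im h
  simp at this
  linarith

theorem sub_ofReal_ne_zero {z : ℂ} (hz : 0 < z.im) (p : ℝ) : z - p ≠ 0 := by
  intro h
  have := congrArg Complex.im h
  simp at this
  linarith

theorem add_one_ne_zero_of_im_pos {z : ℂ} (hz : 0 < z.im) : z + 1 ≠ 0 := by
  simpa using add_ofReal_ne_zero hz 1

theorem letterMap_im_pos (b : Bool) {z : ℂ} (hz : 0 < z.im) : 0 < (letterMap b z).im := by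
  cases b
  · simp only [letterMap, Bool.false_eq_true, if_false]
    rw [Complex.div_im, div_sub_div_same]
    apply div_pos _ (Complex.normSq_pos.2 (add_one_ne_zero_of_im_pos hz))
    simp
    linarith
  · simpa [letterMap] using hz

theorem coe_letter_smul (b : Bool) (τ : ℍ) : ((letter b • τ : ℍ) : ℂ) = letterMap b τ := by
  have hT : T.1 = !![1, 1; 0, 1] := rfl
  have hV : V.1 = !![1, 0; 1, 1] := rfl
  rw [UpperHalfPlane.coe_specialLinearGroup_apply]
  cases b <;> simp [letter, letterMap, hT, hV]

theorem coe_wordMatrix_smul (l : List Bool) (τ : ℍ) :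
    ((wordMatrix l • τ : ℍ) : ℂ) = wordMap l τ := by
  induction l with
  | nil => simp
  | cons b l ih => rw [wordMatrix_cons, mul_smul, coe_letter_smul, ih, wordMap_cons]

/-- `F` is a primitive of `(1 / (z + r) - 1 / (z - p)) h(z)` on the upper half plane. -/
def IsGeodesicPrimitive (h : ℂ → ℂ) (p r : ℝ) (F : ℂ → ℂ) : Prop :=
  ∀ z : ℂ, 0 < z.im → HasDerivAt F (h z * (1 / (z + r) - 1 / (z - p))) z

theorem differentiableOn_geodesic {h : ℂ → ℂ} (hd : DifferentiableOn ℂ h {z | 0 < z.im})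
    (p r : ℝ) :
    DifferentiableOn ℂ (fun z => h z * (1 / (z + r) - 1 / (z - p))) {z | 0 < z.im} :=
  hd.mul (((differentiableOn_const _).div (by fun_prop) fun _ hz => add_ofReal_ne_zero hz r).sub
    ((differentiableOn_const _).div (by fun_prop) fun _ hz => sub_ofReal_ne_zero hz p))

/-- The form `dz / (z + r) - dz / (z - p)` is determined by its simple poles and their residues
`±1`, so its pullback under a Möbius map has the same shape with poles at the preimages. The
preimage of `letterEval b p` is `p`, and that of `-r` is `-letterEval b r`: the letter is undone at
one end and applied at the other. -/
theorem IsGeodesicPrimitive.comp_letterMap {h : ℂ → ℂ} {p r : ℝ} {F : ℂ → ℂ} {b : Bool}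
    (hinv : ∀ b z, 0 < z.im → h (letterMap b z) = h z) (hp : 0 ≤ p) (hr : 0 ≤ r)
    (hF : IsGeodesicPrimitive h (letterEval b p) r F) :
    IsGeodesicPrimitive h p (letterEval b r) (fun z => F (letterMap b z)) := by
  intro z hz
  have h1 := hF _ (letterMap_im_pos b hz)
  rw [hinv b z hz] at h1
  cases b
  · have hz1 := add_one_ne_zero_of_im_pos hz
    have hm : HasDerivAt (letterMap false) (1 / (z + 1) ^ 2) z := by
      have hh := (hasDerivAt_id z).div ((hasDerivAt_id z).add_const 1) hz1
      refine hh.congr_deriv ?_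
      simp only [id]
      congr 1; ring
    have h2 := h1.comp z hm
    refine h2.congr_deriv ?_
    rw [mul_assoc]
    congr 1
    have hr1 : (r : ℂ) + 1 ≠ 0 := by exact_mod_cast (by positivity : r + 1 ≠ 0)
    have hp1 : (p : ℂ) + 1 ≠ 0 := by exact_mod_cast (by positivity : p + 1 ≠ 0)
    have n1 := sub_ofReal_ne_zero hz p
    have n2 := add_ofReal_ne_zero hz (r / (r + 1))
    simp only [letterEval, letterMap, Bool.false_eq_true, if_false]
    push_cast at n2 ⊢
    have n3 : z * (r + 1) + r ≠ 0 := by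
      have : z * (r + 1) + r = (z + r / (r + 1)) * (r + 1) := by field_simp
      rw [this]; exact mul_ne_zero n2 hr1
    have e1 : z / (z + 1) + (r : ℂ) = (z * (r + 1) + r) / (z + 1) := by
      field_simp; ring
    have e2 : z / (z + 1) - (p : ℂ) / (p + 1) = (z - p) / ((z + 1) * (p + 1)) := by
      field_simp; ring
    have e3 : z + (r : ℂ) / (r + 1) = (z * (r + 1) + r) / (r + 1) := by field_simp
    rw [e1, e2, e3]
    field_simp
    ring
  · have hm : HasDerivAt (letterMap true) 1 z := by
      exact (hasDerivAt_id z).add_const 1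
    have h2 := h1.comp z hm
    refine h2.congr_deriv ?_
    rw [mul_one]
    simp only [letterEval, letterMap, if_true]
    push_cast
    congr 3 <;> ring

/-- Letters are pulled back starting with the outermost one, which therefore acts first on `r`; this
is where the reversed word comes from. -/
theorem IsGeodesicPrimitive.comp_wordMap {h : ℂ → ℂ} {p r : ℝ} {F : ℂ → ℂ} {l : List Bool}
    (hinv : ∀ b z, 0 < z.im → h (letterMap b z) = h z) (hp : 0 ≤ p) (hr : 0 ≤ r)
    (hF : IsGeodesicPrimitive h (wordEval l p) r F) :
    IsGeodesicPrimitive h p (wordEval l.reverse r) (fun z => F (wordMap l z)) := by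
  induction l generalizing r F with
  | nil => exact hF
  | cons b l ih =>
    have h1 := IsGeodesicPrimitive.comp_letterMap hinv (wordEval_nonneg l hp) hr hF
    have h2 := ih (letterEval_nonneg b hr) h1
    rw [List.reverse_cons, wordEval_append]
    exact h2

/-- The increment of a primitive along the orbit of a point under a word that fixes the form does
not depend on the point. -/
theorem IsGeodesicPrimitive.increment_eq {h : ℂ → ℂ} {p r : ℝ} {F : ℂ → ℂ} {l : List Bool}
    (hinv : ∀ b z, 0 < z.im → h (letterMap b z) = h z) (hp : 0 ≤ p) (hr : 0 ≤ r)
    (hF : IsGeodesicPrimitive h p r F) (hpl : wordEval l p = p) (hrl : wordEval l.reverse r = r)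
    {z w : ℂ} (hz : 0 < z.im) (hw : 0 < w.im) :
    F (wordMap l z) - F z = F (wordMap l w) - F w := by
  have hF' : IsGeodesicPrimitive h p r (fun z => F (wordMap l z)) := by
    have := IsGeodesicPrimitive.comp_wordMap (l := l) hinv hp hr (by rwa [hpl])
    rwa [hrl] at this
  have hder : ∀ z : ℂ, 0 < z.im → HasDerivAt (fun z => F (wordMap l z) - F z) 0 z := by
    intro z hz
    exact ((hF' z hz).sub (hF z hz)).congr_deriv (sub_self _)
  exact isOpen_lt continuous_const Complex.continuous_im |>.is_const_of_deriv_eq_zero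
    (convex_halfSpace_im_gt 0).isPreconnected
    (fun z hz => (hder z hz).differentiableAt.differentiableWithinAt)
    (fun z hz => (hder z hz).deriv) hz hw

/-! ### The integral along the arc -/

/-- The weight on the arc given by the values of `h`. -/
noncomputable def arcWeight (h : ℂ → ℂ) (t : ℝ) : ℝ :=
  (h (Complex.exp (t * Complex.I))).re * Real.sin t

theorem exp_arc_im (t : ℝ) : (Complex.exp (t * Complex.I)).im = Real.sin t :=
  Complex.exp_ofReal_mul_I_im t

theorem sin_pos_of_mem_arc {t : ℝ} (ht : t ∈ Icc (π / 3) (2 * π / 3)) : 0 < Real.sin t :=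
  Real.sin_pos_of_pos_of_lt_pi (by linarith [ht.1, Real.pi_pos]) (by linarith [ht.2, Real.pi_pos])

theorem exp_arc_im_pos {t : ℝ} (ht : t ∈ Icc (π / 3) (2 * π / 3)) :
    0 < (Complex.exp (t * Complex.I)).im := by
  rw [exp_arc_im]; exact sin_pos_of_mem_arc ht

theorem continuousOn_arcWeight {h : ℂ → ℂ} (hd : DifferentiableOn ℂ h {z | 0 < z.im}) :
    ContinuousOn (arcWeight h) (Icc (π / 3) (2 * π / 3)) := by
  unfold arcWeight
  refine ContinuousOn.mul (Complex.continuous_re.comp_continuousOn ?_)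
    Real.continuous_sin.continuousOn
  exact hd.continuousOn.comp (by fun_prop) fun t ht => exp_arc_im_pos ht

/-- The denominator of the kernel is `|exp (it) - w|²`. -/
theorem re_arc_form (t w : ℝ) :
    (Complex.I * Complex.exp (t * Complex.I) / (Complex.exp (t * Complex.I) - w)).re =
      Real.sin t * arcKernel t w := by
  have hs := Real.sin_sq_add_cos_sq t
  have hre : (Complex.exp (t * Complex.I)).re = Real.cos t := Complex.exp_ofReal_mul_I_re t
  have hn : Complex.normSq (Complex.exp (t * Complex.I) - w) =
      w ^ 2 - 2 * w * Real.cos t + 1 := by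
    rw [Complex.normSq_apply]
    simp only [Complex.sub_re, Complex.sub_im, hre, exp_arc_im, Complex.ofReal_re,
      Complex.ofReal_im]
    linear_combination hs
  rw [Complex.div_re, hn, ← add_div, arcKernel, ← mul_div_assoc]
  congr 1
  simp only [Complex.mul_re, Complex.mul_im, Complex.I_re, Complex.I_im, Complex.sub_re,
    Complex.sub_im, hre, exp_arc_im, Complex.ofReal_re, Complex.ofReal_im]
  ring

theorem re_arc_form_neg (t r : ℝ) :
    (Complex.I * Complex.exp (t * Complex.I) / (Complex.exp (t * Complex.I) + r)).re =
      -(Real.sin t * arcKernel (π - t) r) := by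
  have := re_arc_form t (-r)
  rw [Complex.ofReal_neg, sub_neg_eq_add] at this
  rw [this, arcKernel, arcKernel, Real.cos_pi_sub, neg_div, mul_neg]
  congr 4; ring

/-- The two letters agree here because `T⁻¹V` is elliptic with fixed point `exp (2πi/3)`. Hence
every letter contributes the same arc. -/
theorem letterMap_rho (b : Bool) :
    letterMap b (Complex.exp ((2 * π / 3 : ℝ) * Complex.I)) =
      Complex.exp ((π / 3 : ℝ) * Complex.I) := by
  have key : Complex.exp ((2 * π / 3 : ℝ) * Complex.I) + 1 =
      Complex.exp ((π / 3 : ℝ) * Complex.I) := by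
    apply Complex.ext
    · rw [Complex.add_re, Complex.exp_ofReal_mul_I_re, Complex.exp_ofReal_mul_I_re,
        show 2 * π / 3 = π - π / 3 by ring, Real.cos_pi_sub, Real.cos_pi_div_three, Complex.one_re]
      norm_num
    · rw [Complex.add_im, Complex.exp_ofReal_mul_I_im, Complex.exp_ofReal_mul_I_im,
        show 2 * π / 3 = π - π / 3 by ring, Real.sin_pi_sub, Complex.one_im, add_zero]
  cases b
  · simp only [letterMap, Bool.false_eq_true, if_false]
    rw [key, ← Complex.exp_sub]
    congr 1
    push_cast; ring
  · simpa [letterMap] using key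

/-- The involution `z ↦ -1/z` reflects the arc, `exp (it)` going to `exp (i(π - t))`. -/
theorem arcWeight_pi_sub {h : ℂ → ℂ} (hS : ∀ z : ℂ, 0 < z.im → h (-1 / z) = h z) {t : ℝ}
    (ht : t ∈ Icc (π / 3) (2 * π / 3)) : arcWeight h (π - t) = arcWeight h t := by
  unfold arcWeight
  rw [Real.sin_pi_sub, ← hS _ (exp_arc_im_pos ht)]
  congr 3
  rw [← Complex.exp_pi_mul_I, ← Complex.exp_sub]
  congr 1
  push_cast; ring

theorem integral_arcWeight_mul_reflected {h : ℂ → ℂ}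
    (hS : ∀ z : ℂ, 0 < z.im → h (-1 / z) = h z) (r : ℝ) :
    ∫ t in (π / 3)..(2 * π / 3), arcWeight h t * arcKernel (π - t) r =
      arcPotential (arcWeight h) r := by
  have e : ∫ t in (π / 3)..(2 * π / 3), arcWeight h t * arcKernel (π - t) r =
      ∫ t in (π / 3)..(2 * π / 3), arcWeight h (π - t) * arcKernel (π - t) r := by
    apply intervalIntegral.integral_congr
    intro t ht
    rw [uIcc_of_le pi_div_three_le] at ht
    simp only [arcWeight_pi_sub hS ht]
  rw [e, intervalIntegral.integral_comp_sub_left (fun t => arcWeight h t * arcKernel t r) π,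
    arcPotential]
  congr 1 <;> ring

/-- With `h` real on the arc, only the real part of the form matters. The pole at `p` yields the
kernel at `t`, the pole at `-r` the kernel at `π - t`, and the symmetry of the weight turns both
into the same potential. The arc runs from `2π/3` down to `π/3`, whence the signs. -/
theorem IsGeodesicPrimitive.re_increment_arc {h : ℂ → ℂ} {p r : ℝ} {F : ℂ → ℂ}
    (hd : DifferentiableOn ℂ h {z | 0 < z.im}) (hS : ∀ z : ℂ, 0 < z.im → h (-1 / z) = h z)
    (hreal : ∀ t ∈ Icc (π / 3) (2 * π / 3), (h (Complex.exp (t * Complex.I))).im = 0)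
    (hp : 0 ≤ p) (hr : 0 ≤ r) (hF : IsGeodesicPrimitive h p r F) :
    (F (Complex.exp ((π / 3 : ℝ) * Complex.I))).re -
      (F (Complex.exp ((2 * π / 3 : ℝ) * Complex.I))).re =
    arcPotential (arcWeight h) p + arcPotential (arcWeight h) r := by
  have hw := continuousOn_arcWeight hd
  have hrefl : ∀ t ∈ Icc (π / 3) (2 * π / 3), π - t ∈ Icc (π / 3) (2 * π / 3) := fun t ht =>
    ⟨by linarith [ht.2], by linarith [ht.1]⟩
  have i1 : IntervalIntegrable (fun t => arcWeight h t * arcKernel t p) MeasureTheory.volume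
      (π / 3) (2 * π / 3) := intervalIntegrable_arc (hw.mul (continuousOn_arcKernel hp))
  have i2 : IntervalIntegrable (fun t => arcWeight h t * arcKernel (π - t) r)
      MeasureTheory.volume (π / 3) (2 * π / 3) :=
    intervalIntegrable_arc (hw.mul ((continuousOn_arcKernel hr).comp (by fun_prop) hrefl))
  have hder : ∀ t ∈ uIcc (π / 3) (2 * π / 3),
      HasDerivAt (fun t : ℝ => (F (Complex.exp (t * Complex.I))).re)
        (-(arcWeight h t * arcKernel t p + arcWeight h t * arcKernel (π - t) r)) t := by
    intro t ht
    rw [uIcc_of_le pi_div_three_le] at ht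
    have hexp : HasDerivAt (fun t : ℝ => Complex.exp (t * Complex.I))
        (Complex.exp (t * Complex.I) * Complex.I) t := by
      have h1 : HasDerivAt (fun t : ℝ => (t : ℂ) * Complex.I) Complex.I t := by
        simpa using (Complex.ofRealCLM.hasDerivAt (x := t)).mul_const Complex.I
      exact h1.cexp
    have h2 := HasDerivAt.scomp t (hF _ (exp_arc_im_pos ht)) hexp
    have h3 := Complex.reCLM.hasFDerivAt.comp_hasDerivAt t h2
    refine h3.congr_deriv ?_
    rw [smul_eq_mul, Complex.reCLM_apply]
    have e : Complex.exp (t * Complex.I) * Complex.I * (h (Complex.exp (t * Complex.I)) *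
        (1 / (Complex.exp (t * Complex.I) + r) - 1 / (Complex.exp (t * Complex.I) - p))) =
        h (Complex.exp (t * Complex.I)) *
        (Complex.I * Complex.exp (t * Complex.I) / (Complex.exp (t * Complex.I) + r) -
          Complex.I * Complex.exp (t * Complex.I) / (Complex.exp (t * Complex.I) - p)) := by ring
    rw [e, Complex.mul_re, hreal t ht, zero_mul, sub_zero, Complex.sub_re, re_arc_form,
      re_arc_form_neg, arcWeight]
    ring
  have hint := intervalIntegral.integral_eq_sub_of_hasDerivAt hder (i1.add i2).neg
  rw [intervalIntegral.integral_neg, intervalIntegral.integral_add i1 i2,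
    integral_arcWeight_mul_reflected hS] at hint
  rw [arcPotential]
  linarith

/-- Induction strips the outermost letter: its arc is treated by `re_increment_arc`, and the rest is
the same problem for the pulled-back primitive. The backward orbit enters with its values before
each letter, whereas `wordSum` takes those after; the last two terms correct this and cancel once
`r` is fixed. -/
theorem IsGeodesicPrimitive.re_increment_word {h : ℂ → ℂ} {p r : ℝ} {F : ℂ → ℂ} {l : List Bool}
    (hd : DifferentiableOn ℂ h {z | 0 < z.im})
    (hinv : ∀ b z, 0 < z.im → h (letterMap b z) = h z)
    (hS : ∀ z : ℂ, 0 < z.im → h (-1 / z) = h z)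
    (hreal : ∀ t ∈ Icc (π / 3) (2 * π / 3), (h (Complex.exp (t * Complex.I))).im = 0)
    (hp : 0 ≤ p) (hr : 0 ≤ r) (hF : IsGeodesicPrimitive h (wordEval l p) r F) :
    (F (wordMap l (Complex.exp ((2 * π / 3 : ℝ) * Complex.I)))).re -
      (F (Complex.exp ((2 * π / 3 : ℝ) * Complex.I))).re =
    wordSum (arcPotential (arcWeight h)) l p +
      wordSum (arcPotential (arcWeight h)) l.reverse r + arcPotential (arcWeight h) r -
      arcPotential (arcWeight h) (wordEval l.reverse r) := by
  induction l generalizing r F with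
  | nil => simp [wordSum]
  | cons b l ih =>
    have h1 := IsGeodesicPrimitive.comp_letterMap hinv (wordEval_nonneg l hp) hr hF
    have h2 := ih (letterEval_nonneg b hr) h1
    have h3 := hF.re_increment_arc hd hS hreal (wordEval_nonneg _ hp) hr
    rw [letterMap_rho] at h2
    rw [List.reverse_cons, wordSum_append, wordEval_append, wordMap_cons]
    simp only [wordSum, wordEval_cons, wordEval_nil] at h3 ⊢
    linarith

/-! ### The cycle integral of a word -/

/-- The fixed points of a hyperbolic word. -/
theorem exists_fixed_points {l : List Bool} (hl : IsHyperbolic (wordMatrix l)) :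
    ∃ p r : ℝ, 0 < p ∧ 0 < r ∧ wordEval l p = p ∧ wordEval l.reverse r = r ∧
      ∀ z : ℂ, 0 < z.im → (√((cycleForm (wordMatrix l)).disc : ℝ) : ℝ) /
        (cycleForm (wordMatrix l)).evalOne z = 1 / (z + r) - 1 / (z - p) := by
  obtain ⟨-, hD, hfix, hrep, hatt, hsgn⟩ := cycleForm_spec _ hl
  obtain ⟨h1, h2, h3, h4, -⟩ := wordMatrix_bounds_real l
  obtain ⟨m1, m2, m3, m4⟩ := wordMatrix_reverse l
  have hdet := det_real (wordMatrix l)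
  have hw := hfix _ (Or.inl rfl)
  have hw' := hfix _ (Or.inr rfl)
  have hs2 : √((cycleForm (wordMatrix l)).disc : ℝ) ^ 2 = ((cycleForm (wordMatrix l)).disc : ℝ) :=
    Real.sq_sqrt (by exact_mod_cast hD.le)
  have hlp := fun p (hp : (0 : ℝ) ≤ p) => wordEval_eq l hp
  have hlr := fun p (hp : (0 : ℝ) ≤ p) => wordEval_eq l.reverse hp
  rw [m1, m2, m3, m4] at hlr
  have hne : (cycleForm (wordMatrix l)).root ≠ (cycleForm (wordMatrix l)).root' := by
    intro h
    rw [h] at hrep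
    linarith
  have ha : ((cycleForm (wordMatrix l)).a : ℝ) ≠ 0 := by
    intro h
    rw [h, sign_zero, eq_comm, sign_eq_zero_iff, sub_eq_zero] at hsgn
    exact hne hsgn
  have hev : ∀ z : ℂ, 0 < z.im → (√((cycleForm (wordMatrix l)).disc : ℝ) : ℝ) /
        (cycleForm (wordMatrix l)).evalOne z =
      1 / (z - (cycleForm (wordMatrix l)).root) - 1 / (z - (cycleForm (wordMatrix l)).root') := by
    intro z hz
    have haC : ((cycleForm (wordMatrix l)).a : ℂ) ≠ 0 := by exact_mod_cast ha
    have n1 := sub_ofReal_ne_zero hz (cycleForm (wordMatrix l)).root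
    have n2 := sub_ofReal_ne_zero hz (cycleForm (wordMatrix l)).root'
    have e1 : (cycleForm (wordMatrix l)).root - (cycleForm (wordMatrix l)).root' =
        √((cycleForm (wordMatrix l)).disc : ℝ) / (cycleForm (wordMatrix l)).a := by
      unfold BinForm.root BinForm.root'
      field_simp; ring
    have e2 : (cycleForm (wordMatrix l)).root + (cycleForm (wordMatrix l)).root' =
        -(cycleForm (wordMatrix l)).b / (cycleForm (wordMatrix l)).a := by
      unfold BinForm.root BinForm.root'
      field_simp; ring
    have e3 : (cycleForm (wordMatrix l)).root * (cycleForm (wordMatrix l)).root' =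
        (cycleForm (wordMatrix l)).c / (cycleForm (wordMatrix l)).a := by
      have hdisc : ((cycleForm (wordMatrix l)).disc : ℝ) = (cycleForm (wordMatrix l)).b ^ 2 -
        4 * (cycleForm (wordMatrix l)).a * (cycleForm (wordMatrix l)).c := by
        unfold BinForm.disc; push_cast; ring
      unfold BinForm.root BinForm.root'
      field_simp
      linear_combination -hs2 - hdisc
    have e1' := congrArg (fun x : ℝ => (x : ℂ)) e1
    have e2' := congrArg (fun x : ℝ => (x : ℂ)) e2
    have e3' := congrArg (fun x : ℝ => (x : ℂ)) e3
    push_cast at e1' e2' e3'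
    have e4 : (cycleForm (wordMatrix l)).evalOne z = (cycleForm (wordMatrix l)).a *
        ((z - (cycleForm (wordMatrix l)).root) * (z - (cycleForm (wordMatrix l)).root')) := by
      have : (z - ((cycleForm (wordMatrix l)).root : ℂ)) * (z - (cycleForm (wordMatrix l)).root') =
          z ^ 2 - z * (((cycleForm (wordMatrix l)).root : ℂ) + (cycleForm (wordMatrix l)).root') +
          (cycleForm (wordMatrix l)).root * (cycleForm (wordMatrix l)).root' := by ring
      rw [this, e2', e3', BinForm.evalOne]
      field_simp; ring
    rw [e4, ← div_div, ← e1', div_sub_div _ _ n1 n2]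
    congr 1; ring
  generalize (cycleForm (wordMatrix l)).root = w at *
  generalize (cycleForm (wordMatrix l)).root' = w' at *
  generalize (wordMatrix l 0 0 : ℝ) = α at *
  generalize (wordMatrix l 0 1 : ℝ) = β at *
  generalize (wordMatrix l 1 0 : ℝ) = γ at *
  generalize (wordMatrix l 1 1 : ℝ) = δ at *
  obtain ⟨hw0, hw⟩ := hw
  obtain ⟨hw0', hw'⟩ := hw'
  have q := (div_eq_iff hw0).1 hw
  have q' := (div_eq_iff hw0').1 hw'
  -- At a non-negative point the factor `γ w + δ` is at least 1, so the point is not repelling.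
  have hwneg : w < 0 := by
    by_contra! hc
    have := (abs_lt.1 hrep).2
    nlinarith
  have hsum : γ * (w + w') = α - δ := by
    apply mul_right_cancel₀ (sub_ne_zero.2 hne)
    linear_combination q' - q
  have hprod : γ * (w * w') = -β := by linear_combination w * hsum + q
  -- The product of the fixed points is `-β/γ ≤ 0` when `γ ≠ 0`, so only `β = 0` could spoil
  -- positivity; this is excluded by the sizes of `γ w + δ` and `γ w' + δ`.
  have hw'pos : 0 < w' := by
    by_contra! hc
    have hβ : β = 0 := by nlinarith [mul_nonneg_of_nonpos_of_nonpos hwneg.le hc]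
    rw [hβ, zero_mul, sub_zero] at hdet
    rw [hβ, neg_zero] at hprod
    rcases mul_eq_zero.1 hprod with hγ | hz
    · rw [hγ, zero_mul, zero_add] at hrep
      exact absurd (abs_lt.1 hrep).2 (by linarith)
    · rcases mul_eq_zero.1 hz with hz | hz
      · linarith
      · rw [hz, mul_zero, zero_add, abs_of_pos (by linarith)] at hatt
        nlinarith
  -- The matrix of the reversed word is the inverse conjugated by `z ↦ -z`, so it fixes `-w`.
  refine ⟨w', -w, hw'pos, neg_pos.2 hwneg, ?_, ?_, ?_⟩
  · rw [hlp _ hw'pos.le, hw']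
  · rw [hlr _ (neg_pos.2 hwneg).le, div_eq_iff (by nlinarith)]
    linear_combination q
  · intro z hz
    rw [hev z hz]
    push_cast
    rw [sub_eq_add_neg z (w : ℂ)]

/-! ### Transfer of the modular function to `ℂ` -/

theorem differentiableOn_of_isWeaklyHolomorphic {f : ℍ → ℂ}
    (hf : IsWeaklyHolomorphicModularFunction f) :
    DifferentiableOn ℂ (fun z => f (ofComplex z)) {z | 0 < z.im} :=
  UpperHalfPlane.mdifferentiable_iff.1 hf.holo

theorem ofComplex_eq {z : ℂ} {τ : ℍ} (h : z = τ) : ofComplex z = τ := by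
  rw [h, ofComplex_apply]

theorem invariant_letterMap {f : ℍ → ℂ} (hf : IsWeaklyHolomorphicModularFunction f) (b : Bool)
    (z : ℂ) (hz : 0 < z.im) : f (ofComplex (letterMap b z)) = f (ofComplex z) := by
  rw [← hf.invariant (letter b) (ofComplex z)]
  congr 1
  apply ofComplex_eq
  rw [coe_letter_smul, ofComplex_apply_of_im_pos hz]

theorem invariant_neg_inv {f : ℍ → ℂ} (hf : IsWeaklyHolomorphicModularFunction f)
    (z : ℂ) (hz : 0 < z.im) : f (ofComplex (-1 / z)) = f (ofComplex z) := by
  rw [← hf.invariant ModularGroup.S (ofComplex z)]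
  congr 1
  apply ofComplex_eq
  rw [UpperHalfPlane.coe_specialLinearGroup_apply, ofComplex_apply_of_im_pos hz]
  simp [ModularGroup.S]

theorem nonneg_on_arc {f : ℍ → ℂ} (hpos : NonnegOnArc f) {t : ℝ}
    (ht : t ∈ Icc (π / 3) (2 * π / 3)) :
    (f (ofComplex (Complex.exp (t * Complex.I)))).im = 0 ∧
      0 ≤ (f (ofComplex (Complex.exp (t * Complex.I)))).re := by
  apply hpos t ht
  rw [ofComplex_apply_of_im_pos (exp_arc_im_pos ht)]

/-- The potential of a modular function. -/
noncomputable def potential (f : ℍ → ℂ) : ℝ → ℝ :=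
  arcPotential (arcWeight fun z => f (ofComplex z))

theorem exists_isFareyPotential {f : ℍ → ℂ} (hf : IsWeaklyHolomorphicModularFunction f)
    (hpos : NonnegOnArc f) : ∃ L, IsFareyPotential (potential f) L :=
  ⟨_, isFareyPotential_arcPotential
    (continuousOn_arcWeight (differentiableOn_of_isWeaklyHolomorphic hf))
    fun _ ht => mul_nonneg (nonneg_on_arc hpos ht).2 (sin_pos_of_mem_arc ht).le⟩

/-- The real part of the cycle integral of a hyperbolic word is a sum of values of the potential
along the orbits of the fixed points. -/
theorem exists_re_cycleIntegral_eq {f : ℍ → ℂ} (hf : IsWeaklyHolomorphicModularFunction f)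
    (hpos : NonnegOnArc f) {l : List Bool} (hl : IsHyperbolic (wordMatrix l)) :
    ∃ p r : ℝ, 0 < p ∧ 0 < r ∧ wordEval l p = p ∧ wordEval l.reverse r = r ∧
      (cycleIntegral f (wordMatrix l)).re =
        wordSum (potential f) l p + wordSum (potential f) l.reverse r := by
  obtain ⟨p, r, hp, hr, hpl, hrl, hform⟩ := exists_fixed_points hl
  refine ⟨p, r, hp, hr, hpl, hrl, ?_⟩
  have hd := differentiableOn_of_isWeaklyHolomorphic hf
  have hinv := invariant_letterMap hf
  have hgd := differentiableOn_geodesic hd p r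
  obtain ⟨F, hF⟩ := exists_primitive_upperHalfPlane hgd
  have hFp : IsGeodesicPrimitive (fun z => f (ofComplex z)) p r F := hF
  have hI : 0 < Complex.I.im := by simp
  have hA : 0 < ((wordMatrix l • UpperHalfPlane.I : ℍ) : ℂ).im := UpperHalfPlane.im_pos _
  have hline : ∀ s ∈ Icc (0 : ℝ) 1, 0 < (AffineMap.lineMap (Complex.I : ℂ)
      ((wordMatrix l • UpperHalfPlane.I : ℍ) : ℂ) s).im := fun s hs =>
    (convex_halfSpace_im_gt 0).lineMap_mem hI hA hs
  have hlineDer : ∀ s : ℝ, HasDerivAt (fun s : ℝ => AffineMap.lineMap (Complex.I : ℂ)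
      ((wordMatrix l • UpperHalfPlane.I : ℍ) : ℂ) s)
      (((wordMatrix l • UpperHalfPlane.I : ℍ) : ℂ) - Complex.I) s := fun s =>
    AffineMap.hasDerivAt_lineMap
  have hint : cycleIntegral f (wordMatrix l) =
      F ((wordMatrix l • UpperHalfPlane.I : ℍ) : ℂ) - F Complex.I := by
    rw [cycleIntegral, if_pos hl]
    have hder : ∀ s ∈ uIcc (0 : ℝ) 1, HasDerivAt
        (fun s : ℝ => F (AffineMap.lineMap (Complex.I : ℂ)
          ((wordMatrix l • UpperHalfPlane.I : ℍ) : ℂ) s))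
        (cycleIntegrand f (cycleForm (wordMatrix l)) (AffineMap.lineMap (Complex.I : ℂ)
          ((wordMatrix l • UpperHalfPlane.I : ℍ) : ℂ) s) *
          (((wordMatrix l • UpperHalfPlane.I : ℍ) : ℂ) - Complex.I)) s := by
      intro s hs
      rw [uIcc_of_le zero_le_one] at hs
      have h := HasDerivAt.scomp s (hF _ (hline s hs)) (hlineDer s)
      refine h.congr_deriv ?_
      rw [cycleIntegrand, mul_div_assoc, hform _ (hline s hs), smul_eq_mul, mul_comm]
    rw [intervalIntegral.integral_eq_sub_of_hasDerivAt hder]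
    · simp
    · apply ContinuousOn.intervalIntegrable
      rw [uIcc_of_le zero_le_one]
      refine ContinuousOn.mul ?_ continuousOn_const
      have hc := hgd.continuousOn.comp
        (fun s _ => (hlineDer s).continuousAt.continuousWithinAt) hline
      refine hc.congr fun s hs => ?_
      simp only [Function.comp]
      rw [cycleIntegrand, mul_div_assoc, hform _ (hline s hs)]
  -- The increment of `F` does not depend on the base point, which is moved from `i` to `exp
  -- (2πi/3)`, where the arcs of successive letters join up.
  have hρ : (2 * π / 3) ∈ Icc (π / 3) (2 * π / 3) := ⟨pi_div_three_le, le_rfl⟩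
  rw [hint, coe_wordMatrix_smul, UpperHalfPlane.coe_I,
    hFp.increment_eq hinv hp.le hr.le hpl hrl hI (exp_arc_im_pos hρ), Complex.sub_re,
    IsGeodesicPrimitive.re_increment_word (l := l) (p := p) (r := r) hd hinv
      (invariant_neg_inv hf) (fun t ht => (nonneg_on_arc hpos ht).1) hp.le hr.le (by rwa [hpl]), hrl,
    add_sub_cancel_right]
  rfl

/-! ### Averages of cycle integrals along Farey paths -/

/-- The trace is `2α + β + γ + δ ≥ 3` in terms of the entries `α, β, γ, δ` of `wordMatrix l`. -/
theorem isHyperbolic_wordMatrix (l : List Bool) :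
    IsHyperbolic (wordMatrix (true :: false :: l)) := by
  obtain ⟨h1, h2, h3, h4, -⟩ := wordMatrix_bounds l
  obtain ⟨e1, e2, e3, e4⟩ := letter_mul_apply false (wordMatrix l)
  obtain ⟨m1, m2, m3, m4⟩ := letter_mul_apply true (letter false * wordMatrix l)
  simp only [if_true, if_false, Bool.false_eq_true] at e1 e2 e3 e4 m1 m2 m3 m4
  rw [IsHyperbolic, wordMatrix_cons, wordMatrix_cons, Matrix.trace_fin_two, m1, m4, e1, e3, e4]
  exact lt_of_lt_of_le (by omega) (le_abs_self _)

theorem re_cycleIntegral_close {f : ℍ → ℂ} (hf : IsWeaklyHolomorphicModularFunction f)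
    (hpos : NonnegOnArc f) {L : ℝ} (hK : IsFareyPotential (potential f) L) {l : List Bool}
    (hl : IsHyperbolic (wordMatrix l)) :
    |(cycleIntegral f (wordMatrix l)).re - twoSidedSum (potential f) l| ≤
      2 * L * harmonicSum l.length := by
  obtain ⟨p, r, hp, hr, -, -, e⟩ := exists_re_cycleIntegral_eq hf hpos hl
  rw [e]
  exact twoSidedSum_close hK l hp.le hr.le

theorem re_cycleIntegral_mem {f : ℍ → ℂ} (hf : IsWeaklyHolomorphicModularFunction f)
    (hpos : NonnegOnArc f) (l : List Bool) :
    0 ≤ (cycleIntegral f (wordMatrix l)).re ∧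
      (cycleIntegral f (wordMatrix l)).re ≤ 2 * potential f Real.goldenRatio * l.length := by
  obtain ⟨L, hK⟩ := exists_isFareyPotential hf hpos
  by_cases hl : IsHyperbolic (wordMatrix l)
  · obtain ⟨p, r, hp, hr, hpl, hrl, e⟩ := exists_re_cycleIntegral_eq hf hpos hl
    have h1 := wordSum_le_of_fixed hK l hp hpl
    have h2 := wordSum_le_of_fixed hK l.reverse hr hrl
    rw [List.length_reverse] at h2
    rw [e]
    exact ⟨add_nonneg (wordSum_nonneg hK _ hp.le) (wordSum_nonneg hK _ hr.le), by linarith⟩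
  · rw [cycleIntegral, if_neg hl, Complex.zero_re]
    have := hK.nonneg _ Real.goldenRatio_pos.le
    exact ⟨le_rfl, by positivity⟩

theorem re_cycleIntegral_div_mem {f : ℍ → ℂ} (hf : IsWeaklyHolomorphicModularFunction f)
    (hpos : NonnegOnArc f) (x : ℝ) (n : ℕ) :
    0 ≤ (cycleIntegral f (fareyMatrix x n)).re / n ∧
      (cycleIntegral f (fareyMatrix x n)).re / n ≤ 2 * potential f Real.goldenRatio := by
  obtain ⟨L, hK⟩ := exists_isFareyPotential hf hpos
  obtain ⟨l, hl, e⟩ := exists_word_fareyMatrix x n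
  obtain ⟨h1, h2⟩ := re_cycleIntegral_mem hf hpos l
  rw [e]
  rw [hl] at h2
  have := hK.nonneg _ Real.goldenRatio_pos.le
  exact ⟨div_nonneg h1 (Nat.cast_nonneg n),
    div_le_of_le_mul₀ (Nat.cast_nonneg n) (by positivity) h2⟩

/-- The limit superior lies between `0` and twice the value of the potential at the golden ratio. -/
theorem lyapunovLimsup_mem {f : ℍ → ℂ} (hf : IsWeaklyHolomorphicModularFunction f)
    (hpos : NonnegOnArc f) (x : ℝ) :
    (0 : EReal) ≤ lyapunovLimsup f x ∧
      lyapunovLimsup f x ≤ ((2 * potential f Real.goldenRatio : ℝ) : EReal) := by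
  constructor
  · exact le_limsup_of_frequently_le' (Frequently.of_forall fun n =>
      EReal.coe_nonneg.2 (re_cycleIntegral_div_mem hf hpos x n).1)
  · exact limsup_le_of_le (h := Eventually.of_forall fun n =>
      EReal.coe_le_coe_iff.2 (re_cycleIntegral_div_mem hf hpos x n).2)

/-- The lower estimate is needed only for infinitely many `n`; both the golden path and the steered
words supply no more than that. -/
theorem limsup_coe_eq {a e : ℕ → ℝ} {y : ℝ} (he : Tendsto e atTop (𝓝 0))
    (hu : ∀ᶠ n in atTop, a n ≤ y + e n) (hl : ∃ᶠ n in atTop, y - e n ≤ a n) :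
    limsup (fun n => (a n : EReal)) atTop = y := by
  apply le_antisymm
  · have h1 : Tendsto (fun n => ((y + e n : ℝ) : EReal)) atTop (𝓝 (y : EReal)) := by
      have := he.const_add y
      rw [add_zero] at this
      exact (continuous_coe_real_ereal.tendsto y).comp this
    rw [← h1.limsup_eq]
    exact limsup_le_limsup (hu.mono fun n hn => EReal.coe_le_coe_iff.2 hn)
  · have h1 : Tendsto (fun n => ((y - e n : ℝ) : EReal)) atTop (𝓝 (y : EReal)) := by
      have := he.const_sub y
      rw [sub_zero] at this
      exact (continuous_coe_real_ereal.tendsto y).comp this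
    apply le_of_forall_lt
    intro c hc
    obtain ⟨d, hcd, hdy⟩ := exists_between hc
    refine hcd.trans_le (le_limsup_of_frequently_le' ?_)
    exact (hl.and_eventually (h1.eventually (lt_mem_nhds hdy))).mono fun n hn =>
      hn.2.le.trans (EReal.coe_le_coe_iff.2 hn.1)

theorem tendsto_error (C D : ℝ) :
    Tendsto (fun n : ℕ => (C + D * harmonicSum n) / n) atTop (𝓝 0) := by
  have h := (tendsto_const_div_atTop_nhds_zero_nat C).add (tendsto_harmonicSum_div.const_mul D)
  simp only [mul_zero, add_zero] at h
  refine h.congr fun n => ?_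
  rw [add_div, mul_div_assoc]

/-- The exponent at the golden ratio. -/
theorem lyapunovLimsup_goldenRatio {f : ℍ → ℂ} (hf : IsWeaklyHolomorphicModularFunction f)
    (hpos : NonnegOnArc f) :
    lyapunovLimsup f Real.goldenRatio = ((2 * potential f Real.goldenRatio : ℝ) : EReal) := by
  obtain ⟨L, hK⟩ := exists_isFareyPotential hf hpos
  refine limsup_coe_eq (tendsto_error 0 (4 * L)) (Eventually.of_forall fun n => ?_) ?_
  · refine (re_cycleIntegral_div_mem hf hpos _ n).2.trans (le_add_of_nonneg_right ?_)
    have := hK.lipschitz_nonneg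
    have := harmonicSum_nonneg n
    positivity
  · rw [frequently_atTop]
    intro N
    -- Even lengths cut the path of `φ` into complete blocks `TV`; at least one block is taken so
    -- that the word is hyperbolic.
    refine ⟨2 * (N + 1), by omega, ?_⟩
    have h1 := fareyMatrix_wordEval (goldenWord (N + 1)) Real.goldenRatio_pos.le
    rw [wordEval_goldenWord, goldenWord_length] at h1
    have h2 := re_cycleIntegral_close hf hpos hK (isHyperbolic_wordMatrix (goldenWord N))
    have h3 := twoSidedSum_goldenWord_ge hK (N + 1)
    change |(cycleIntegral f (wordMatrix (goldenWord (N + 1)))).re -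
      twoSidedSum (potential f) (goldenWord (N + 1))| ≤
      2 * L * harmonicSum (goldenWord (N + 1)).length at h2
    rw [goldenWord_length, abs_le] at h2
    rw [h1]
    have hn : (0 : ℝ) < ((2 * (N + 1) : ℕ) : ℝ) := by positivity
    rw [sub_le_iff_le_add, ← add_div, le_div_iff₀ hn]
    push_cast at h3 ⊢
    linarith [h2.1]

/-! ### Infinite words -/

theorem continuousOn_wordEval (l : List Bool) : ContinuousOn (wordEval l) (Ici 0) := by
  induction l with
  | nil => exact continuousOn_id
  | cons b l ih =>
    have hb : ContinuousOn (letterEval b) (Ici 0) := by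
      cases b
      · refine (continuousOn_id.div (by fun_prop) fun p hp => ?_ : ContinuousOn
          (fun p : ℝ => p / (p + 1)) (Ici 0))
        have : (0 : ℝ) ≤ p := hp
        positivity
      · exact (by fun_prop : ContinuousOn (fun p : ℝ => p + 1) (Ici 0))
    exact hb.comp ih fun p hp => wordEval_nonneg l hp

/-- An infinite word without two consecutive letters `T` is the path of a real number. -/
theorem exists_wordEval_eq {w : ℕ → List Bool} {b : ℕ → Bool}
    (hs : ∀ n, w (n + 1) = w n ++ [b n]) (hb : ∀ n, b n = true → b (n + 1) = false) :
    ∃ x : ℝ, ∀ n, ∃ p, 0 ≤ p ∧ wordEval (w n) p = x := by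
  -- `c n` bounds the tail that begins with the letter `b n`: a tail beginning with `V` is at most
  -- 1, and one beginning with `T` at most 2, since `V` follows. This replaces `[0, ∞)` by compact
  -- intervals with nested images.
  set c : ℕ → ℝ := fun n => if b n then 2 else 1 with hc
  have hc0 : ∀ n, 0 ≤ c n := fun n => by simp only [hc]; split_ifs <;> norm_num
  have hstep : ∀ n, ∀ p ∈ Icc 0 (c (n + 1)), letterEval (b n) p ∈ Icc 0 (c n) := by
    rintro n p ⟨hp0, hp⟩
    refine ⟨letterEval_nonneg _ hp0, ?_⟩
    cases hbn : b n
    · simp only [hc, hbn, letterEval, Bool.false_eq_true, if_false]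
      rw [div_le_one (by linarith)]
      linarith
    · simp only [hc, hb n hbn, Bool.false_eq_true, if_false] at hp
      simp only [hc, hbn, letterEval, if_true]
      linarith
  have hcompact : ∀ n, IsCompact (wordEval (w n) '' Icc 0 (c n)) := fun n =>
    isCompact_Icc.image_of_continuousOn ((continuousOn_wordEval _).mono Icc_subset_Ici_self)
  obtain ⟨x, hx⟩ := IsCompact.nonempty_iInter_of_sequence_nonempty_isCompact_isClosed
    (fun n => wordEval (w n) '' Icc 0 (c n))
    (fun n => by
      rintro _ ⟨p, hp, rfl⟩
      exact ⟨_, hstep n p hp, by rw [hs, wordEval_append, wordEval_cons, wordEval_nil]⟩)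
    (fun n => ⟨_, mem_image_of_mem _ ⟨le_rfl, hc0 n⟩⟩) (hcompact 0)
    (fun n => (hcompact n).isClosed)
  refine ⟨x, fun n => ?_⟩
  obtain ⟨p, hp, e⟩ := mem_iInter.1 hx n
  exact ⟨p, hp.1, e⟩

/-! ### Words with a prescribed average -/

open Classical in
/-- The letter that follows the word `l` when the average of `K` is steered to `y`: it is `T` if the
average is at most `y` and `l` does not end in `T`. -/
noncomputable def steeringLetter (K : ℝ → ℝ) (y : ℝ) (l : List Bool) : Bool :=
  decide (twoSidedSum K l ≤ y * l.length ∧ l.getLast? ≠ some true)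

/-- The words along which the average of `K` is steered to `y`. -/
noncomputable def steeredWord (K : ℝ → ℝ) (y : ℝ) : ℕ → List Bool
  | 0 => []
  | n + 1 => steeredWord K y n ++ [steeringLetter K y (steeredWord K y n)]

section Steering

variable {K : ℝ → ℝ} {L y : ℝ}

theorem steeredWord_succ (K : ℝ → ℝ) (y : ℝ) (n : ℕ) :
    steeredWord K y (n + 1) = steeredWord K y n ++ [steeringLetter K y (steeredWord K y n)] := rfl

theorem steeredWord_length (K : ℝ → ℝ) (y : ℝ) (n : ℕ) : (steeredWord K y n).length = n := by
  induction n with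
  | zero => rfl
  | succ n ih => rw [steeredWord_succ, List.length_append, ih, List.length_singleton]

theorem steeringLetter_append_true (K : ℝ → ℝ) (y : ℝ) (l : List Bool) :
    steeringLetter K y (l ++ [true]) = false := by
  simp [steeringLetter]

theorem steeringLetter_steeredWord (K : ℝ → ℝ) (y : ℝ) (n : ℕ)
    (h : steeringLetter K y (steeredWord K y n) = true) :
    steeringLetter K y (steeredWord K y (n + 1)) = false := by
  rw [steeredWord_succ, h, steeringLetter_append_true]

/-- On the empty word the test reads `0 ≤ y * 0`, so the first letter is `T` for every `y`. The
start `TV` makes all later prefixes hyperbolic and the limit point positive. -/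
theorem steeredWord_two (K : ℝ → ℝ) (y : ℝ) : steeredWord K y 2 = [true, false] := by
  have h1 : steeredWord K y 1 = [] ++ [true] := by
    have : steeringLetter K y [] = true := by
      simp [steeringLetter, twoSidedSum, wordSum]
    rw [steeredWord_succ, steeredWord, this]
  rw [steeredWord_succ, h1, steeringLetter_append_true]
  rfl

theorem exists_steeredWord_eq (K : ℝ → ℝ) (y : ℝ) (n : ℕ) :
    ∃ l, steeredWord K y (n + 2) = true :: false :: l := by
  induction n with
  | zero => exact ⟨[], steeredWord_two K y⟩
  | succ n ih =>
    obtain ⟨l, hl⟩ := ih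
    exact ⟨_, by rw [add_right_comm, steeredWord_succ, hl]; rfl⟩

theorem potential_le (hK : IsFareyPotential K L) {p : ℝ} (hp : 0 ≤ p) : K p ≤ L := by
  have h := hK.lipschitz p 0 hp le_rfl
  rw [hK.zero, zero_div, sub_zero, sub_zero, abs_of_nonneg (hK.nonneg p hp),
    abs_of_nonneg (by positivity)] at h
  refine h.trans (mul_le_of_le_one_right hK.lipschitz_nonneg ?_)
  rw [div_le_one (by positivity)]
  linarith

theorem twoSidedSum_nonneg (hK : IsFareyPotential K L) (l : List Bool) : 0 ≤ twoSidedSum K l :=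
  add_nonneg (wordSum_nonneg hK _ zero_le_one) (wordSum_nonneg hK _ zero_le_one)

theorem twoSidedSum_le_of_length_le_one (hK : IsFareyPotential K L) {l : List Bool}
    (hl : l.length ≤ 1) : twoSidedSum K l ≤ 2 * L := by
  match l, hl with
  | [], _ => simpa [twoSidedSum, wordSum] using hK.lipschitz_nonneg
  | [b], _ =>
    have := potential_le hK (letterEval_nonneg b zero_le_one)
    simp only [twoSidedSum, List.reverse_singleton, wordSum, wordEval_cons, wordEval_nil]
    linarith

/-- Cut after the last earlier prefix `l` whose average is at most `y`: one letter `s` follows it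
freely, and from then on the average exceeds `y`, so only `V` is appended. -/
theorem steeredWord_decomposition (K : ℝ → ℝ) (y : ℝ) (n : ℕ) :
    ∃ (l s : List Bool) (m : ℕ), steeredWord K y n = l ++ (s ++ List.replicate m false) ∧
      s.length ≤ 1 ∧ twoSidedSum K l ≤ y * l.length := by
  induction n with
  | zero => exact ⟨[], [], 0, rfl, by simp, by simp [twoSidedSum, wordSum]⟩
  | succ n ih =>
    by_cases h : twoSidedSum K (steeredWord K y n) ≤ y * (steeredWord K y n).length
    · exact ⟨steeredWord K y n, [steeringLetter K y (steeredWord K y n)], 0, by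
        simp [steeredWord_succ], by simp, h⟩
    · obtain ⟨l, s, m, e, hs, hl⟩ := ih
      refine ⟨l, s, m + 1, ?_, hs, hl⟩
      have : steeringLetter K y (steeredWord K y n) = false := by simp [steeringLetter, h]
      rw [steeredWord_succ, this, List.replicate_succ', e]
      simp only [List.append_assoc]

/-- In the decomposition, `2 * L` pays for the single letter; the two concatenations and the run of
`V` cost `2 * L` times a harmonic sum each. -/
theorem twoSidedSum_steeredWord_le (hK : IsFareyPotential K L) (hy : 0 ≤ y) (n : ℕ) :
    twoSidedSum K (steeredWord K y n) ≤ y * n + (2 * L + 6 * L * harmonicSum n) := by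
  obtain ⟨l, s, m, e, hs, hl⟩ := steeredWord_decomposition K y n
  have hlen : n = l.length + (s.length + m) := by
    have := congrArg List.length e
    rwa [steeredWord_length, List.length_append, List.length_append, List.length_replicate] at this
  have h1 := (abs_le.1 (twoSidedSum_append hK l (s ++ List.replicate m false))).2
  have h2 := (abs_le.1 (twoSidedSum_append hK s (List.replicate m false))).2
  have h3 := twoSidedSum_le_of_length_le_one hK hs
  have h4 := twoSidedSum_replicate_false_le hK m
  rw [← e, steeredWord_length] at h1
  rw [List.length_append, List.length_replicate] at h2
  have hL := hK.lipschitz_nonneg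
  have m1 := mul_le_mul_of_nonneg_left (harmonicSum_mono (show s.length + m ≤ n by omega)) hL
  have m2 := mul_le_mul_of_nonneg_left (harmonicSum_mono (show m ≤ n by omega)) hL
  have m3 : y * l.length ≤ y * n :=
    mul_le_mul_of_nonneg_left (by exact_mod_cast (show l.length ≤ n by omega)) hy
  linarith

/-- If the average were at most `y` from some point on, the rule would append `T` whenever allowed,
so the word would continue as `TVTV⋯` and its average would approach `2 K φ > y`. -/
theorem frequently_lt_twoSidedSum_steeredWord (hK : IsFareyPotential K L)
    (hy : y < 2 * K Real.goldenRatio) :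
    ∃ᶠ n : ℕ in atTop, y * n < twoSidedSum K (steeredWord K y n) := by
  intro hcon
  simp only [not_lt] at hcon
  obtain ⟨N, hN⟩ := eventually_atTop.1 hcon
  have hletter : ∀ n ≥ N, (steeredWord K y n).getLast? ≠ some true →
      steeringLetter K y (steeredWord K y n) = true := by
    intro n hn hlast
    have := hN n hn
    rw [steeringLetter, decide_eq_true_iff, steeredWord_length]
    exact ⟨this, hlast⟩
  -- One more letter may be needed so that the alternation starts with `T`.
  obtain ⟨M, hM, hlast⟩ : ∃ M ≥ N, (steeredWord K y M).getLast? ≠ some true := by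
    by_cases h : (steeredWord K y N).getLast? = some true
    · refine ⟨N + 1, by omega, ?_⟩
      have : steeringLetter K y (steeredWord K y N) = false := by simp [steeringLetter, h]
      rw [steeredWord_succ, this]
      simp
    · exact ⟨N, le_rfl, h⟩
  have hgolden : ∀ m, steeredWord K y (M + 2 * m) = steeredWord K y M ++ goldenWord m ∧
      (steeredWord K y (M + 2 * m)).getLast? ≠ some true := by
    intro m
    induction m with
    | zero => simpa [goldenWord] using hlast
    | succ m ih =>
      have h1 := hletter (M + 2 * m) (by omega) ih.2
      have h2 := steeringLetter_steeredWord K y _ h1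
      have e : steeredWord K y (M + 2 * (m + 1)) =
          steeredWord K y (M + 2 * m) ++ [true, false] := by
        rw [show M + 2 * (m + 1) = M + 2 * m + 1 + 1 by ring, steeredWord_succ, h2,
          steeredWord_succ, h1, List.append_assoc]
        rfl
      refine ⟨by rw [e, ih.1, List.append_assoc, ← goldenWord_succ'], ?_⟩
      rw [e]
      simp
  have hbound : ∀ m : ℕ, 2 * K Real.goldenRatio - y ≤
      (2 * M * K Real.goldenRatio + 4 * L * harmonicSum (M + 2 * (m + 1))) /
        ((M + 2 * (m + 1) : ℕ) : ℝ) := by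
    intro m
    have hL := hK.lipschitz_nonneg
    have h1 := hN (M + 2 * (m + 1)) (by omega)
    have h2 := (abs_le.1 (twoSidedSum_append hK (steeredWord K y M) (goldenWord (m + 1)))).1
    rw [← (hgolden (m + 1)).1, steeredWord_length] at h2
    have h3 := twoSidedSum_nonneg hK (steeredWord K y M)
    have h4 := twoSidedSum_goldenWord_ge hK (m + 1)
    have h5 := mul_le_mul_of_nonneg_left
      (harmonicSum_mono (show 2 * (m + 1) ≤ M + 2 * (m + 1) by omega)) hL
    rw [le_div_iff₀ (by positivity)]
    push_cast at h1 h4 ⊢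
    linarith
  have hlim : Tendsto (fun m : ℕ =>
      (2 * M * K Real.goldenRatio + 4 * L * harmonicSum (M + 2 * (m + 1))) /
        ((M + 2 * (m + 1) : ℕ) : ℝ)) atTop (𝓝 0) :=
    (tendsto_error (2 * M * K Real.goldenRatio) (4 * L)).comp
      (tendsto_atTop_mono (fun m => by simp only [id]; omega) tendsto_id)
  linarith [ge_of_tendsto' hlim hbound]

end Steering

/-- Every value between `0` and the exponent of the golden ratio is an exponent. -/
theorem exists_lyapunovLimsup_eq {f : ℍ → ℂ} (hf : IsWeaklyHolomorphicModularFunction f)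
    (hpos : NonnegOnArc f) {y : ℝ} (hy : 0 ≤ y) (hy' : y < 2 * potential f Real.goldenRatio) :
    ∃ x : ℝ, 0 < x ∧ lyapunovLimsup f x = y := by
  obtain ⟨L, hK⟩ := exists_isFareyPotential hf hpos
  have hL := hK.lipschitz_nonneg
  obtain ⟨x, hx⟩ := exists_wordEval_eq (steeredWord_succ (potential f) y)
    (steeringLetter_steeredWord (potential f) y)
  have hfarey : ∀ n, fareyMatrix x n = wordMatrix (steeredWord (potential f) y n) := by
    intro n
    obtain ⟨p, hp, rfl⟩ := hx n
    simpa only [steeredWord_length] using fareyMatrix_wordEval (steeredWord (potential f) y n) hp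
  have hclose : ∀ n ≥ 2, |(cycleIntegral f (fareyMatrix x n)).re -
      twoSidedSum (potential f) (steeredWord (potential f) y n)| ≤ 2 * L * harmonicSum n := by
    intro n hn
    obtain ⟨k, rfl⟩ := Nat.exists_eq_add_of_le' hn
    have hh : IsHyperbolic (wordMatrix (steeredWord (potential f) y (k + 2))) := by
      obtain ⟨l, hl⟩ := exists_steeredWord_eq (potential f) y k
      rw [hl]
      exact isHyperbolic_wordMatrix l
    have := re_cycleIntegral_close hf hpos hK hh
    rwa [steeredWord_length, ← hfarey] at this
  -- The factor `8 * L` is `6 * L` from the steering bound plus `2 * L` from the passage between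
  -- cycle integral and two-sided sum.
  refine ⟨x, ?_, limsup_coe_eq (tendsto_error (2 * L) (8 * L)) ?_ ?_⟩
  · obtain ⟨p, hp, rfl⟩ := hx 2
    rw [steeredWord_two]
    have := letterEval_nonneg false hp
    simp only [wordEval_cons, wordEval_nil]
    rw [letterEval, if_pos rfl]
    linarith
  · filter_upwards [eventually_ge_atTop 2] with n hn
    have hn0 : (0 : ℝ) < n := by exact_mod_cast (by omega : 0 < n)
    have h1 := (abs_le.1 (hclose n hn)).2
    have h2 := twoSidedSum_steeredWord_le hK hy n
    rw [← sub_le_iff_le_add', le_div_iff₀ hn0, sub_mul, div_mul_cancel₀ _ hn0.ne']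
    linarith
  · refine ((frequently_lt_twoSidedSum_steeredWord hK hy').and_eventually
      (eventually_ge_atTop 2)).mono ?_
    rintro n ⟨h, hn⟩
    have hn0 : (0 : ℝ) < n := by exact_mod_cast (by omega : 0 < n)
    have h1 := (abs_le.1 (hclose n hn)).1
    have h2 := mul_nonneg hL (harmonicSum_nonneg n)
    rw [sub_le_iff_le_add, ← add_div, le_div_iff₀ hn0]
    linarith

/-! ### The exponent on the projective line -/

theorem lyapunov_coe (f : ℍ → ℂ) {x : ℝ} (hx : x ≠ 0) :
    lyapunov f (x : OnePoint ℝ) = (lyapunovLimsup f |x|).toReal :=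
  if_neg hx

theorem lyapunov_goldenRatio {f : ℍ → ℂ} (hf : IsWeaklyHolomorphicModularFunction f)
    (hpos : NonnegOnArc f) :
    lyapunov f (Real.goldenRatio : ℝ) = 2 * potential f Real.goldenRatio := by
  rw [lyapunov_coe f Real.goldenRatio_pos.ne', abs_of_pos Real.goldenRatio_pos,
    lyapunovLimsup_goldenRatio hf hpos, EReal.toReal_coe]

theorem lyapunovLimsup_ne {f : ℍ → ℂ} (hf : IsWeaklyHolomorphicModularFunction f)
    (hpos : NonnegOnArc f) (x : ℝ) : lyapunovLimsup f x ≠ ⊥ ∧ lyapunovLimsup f x ≠ ⊤ := by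
  obtain ⟨h1, h2⟩ := lyapunovLimsup_mem hf hpos x
  exact ⟨(lt_of_lt_of_le EReal.bot_lt_zero h1).ne', (lt_of_le_of_lt h2 (EReal.coe_lt_top _)).ne⟩

theorem lyapunov_mem {f : ℍ → ℂ} (hf : IsWeaklyHolomorphicModularFunction f)
    (hpos : NonnegOnArc f) (x : OnePoint ℝ) :
    0 ≤ lyapunov f x ∧ lyapunov f x ≤ lyapunov f (Real.goldenRatio : ℝ) := by
  obtain ⟨L, hK⟩ := exists_isFareyPotential hf hpos
  have hg := hK.nonneg _ Real.goldenRatio_pos.le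
  rw [lyapunov_goldenRatio hf hpos]
  induction x using OnePoint.rec with
  | infty => exact ⟨le_rfl, show (0 : ℝ) ≤ _ by positivity⟩
  | coe x =>
    by_cases hx : x = 0
    · have : lyapunov f (x : OnePoint ℝ) = 0 := if_pos hx
      rw [this]
      exact ⟨le_rfl, by positivity⟩
    · obtain ⟨h1, h2⟩ := lyapunovLimsup_mem hf hpos |x|
      rw [lyapunov_coe f hx]
      exact ⟨EReal.toReal_nonneg h1,
        EReal.toReal_le_toReal h2 (lyapunovLimsup_ne hf hpos _).1 (EReal.coe_ne_top _)⟩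

/-- Steering needs `y` strictly below the maximum; the maximum itself is attained at `φ`. -/
theorem exists_lyapunov_eq {f : ℍ → ℂ} (hf : IsWeaklyHolomorphicModularFunction f)
    (hpos : NonnegOnArc f) {y : ℝ} (hy : 0 ≤ y)
    (hy' : y ≤ lyapunov f (Real.goldenRatio : ℝ)) : ∃ x : OnePoint ℝ, lyapunov f x = y := by
  rcases hy'.eq_or_lt with h | h
  · exact ⟨_, h.symm⟩
  · rw [lyapunov_goldenRatio hf hpos] at h
    obtain ⟨x, hx, e⟩ := exists_lyapunovLimsup_eq hf hpos hy h
    exact ⟨(x : ℝ), by rw [lyapunov_coe f hx.ne', abs_of_pos hx, e, EReal.toReal_coe]⟩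

end ModularLyapunov

theorem theorem1p3 (f : UpperHalfPlane → ℂ)
    (hf : ModularLyapunov.IsWeaklyHolomorphicModularFunction f) (hf0 : f ≠ 0)
    (hpos : ModularLyapunov.NonnegOnArc f) :
    -- the limit superior that defines the exponent is finite
    (∀ x : ℝ, 0 < x → ModularLyapunov.lyapunovLimsup f x ≠ ⊥ ∧
      ModularLyapunov.lyapunovLimsup f x ≠ ⊤) ∧
    (∀ x : OnePoint ℝ, 0 ≤ ModularLyapunov.lyapunov f x ∧
      ModularLyapunov.lyapunov f x ≤ ModularLyapunov.lyapunov f (Real.goldenRatio : ℝ)) ∧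
    (∀ y : ℝ, 0 ≤ y → y ≤ ModularLyapunov.lyapunov f (Real.goldenRatio : ℝ) →
      ∃ x : OnePoint ℝ, ModularLyapunov.lyapunov f x = y) ∧
    Set.range (ModularLyapunov.lyapunov f) =
      Set.Icc 0 (ModularLyapunov.lyapunov f (Real.goldenRatio : ℝ)) := by
  refine ⟨fun x _ => ModularLyapunov.lyapunovLimsup_ne hf hpos x,
    ModularLyapunov.lyapunov_mem hf hpos,
    fun y hy hy' => ModularLyapunov.exists_lyapunov_eq hf hpos hy hy',
    Set.Subset.antisymm ?_ fun y hy => ModularLyapunov.exists_lyapunov_eq hf hpos hy.1 hy.2⟩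
  rintro _ ⟨x, rfl⟩
  exact ModularLyapunov.lyapunov_mem hf hpos x
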